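/- Let $R$ be an integer with $|R|\ge 2$, let $B\subset\mathbb{Z}$ be finite with $0\in B$, $N:=|B|$, and put $\tau_b(x)=(x+b)/R$ for $b\in B$. Let $\mu=\mu(R,B)$ be the unique Borel probability measure on $\mathbb{R}$ with $\mu(E)=\frac1N\sum_{b\in B}\mu(\tau_b^{-1}(E))$ for all Borel sets $E$, let $X_B=\{\sum_{k\ge1}R^{-k}b_k: b_k\in B\}$, and assume that $\mu$ has no overlap: $\mu(\tau_b(X_B)\cap\tau_{b'}(X_B))=0$ for all $b\neq b'$ in $B$. Let $L\subset\mathbb{Z}$ be finite with $0\in L$ and let $(\alpha_l)_{l\in L}$ be complex numbers such that (i) $\alpha_0=1$; (ii) the matrix $T=\frac1{\sqrt N}\left(e^{2\pi i lb/R}\alpha_l\right)_{l\in L,\,b\in B}$ satisfies $T^*T=I_N$. Write $m_B(x)=\frac1N\sum_{b\in B}e^{2\pi i bx}$, $g_l(t)=(t-l)/R$ and $e_t(x)=e^{2\pi i tx}$. A set $M\subset\mathbb{R}$ is called invariant if $g_l(t)\in M$ whenever $t\in M$, $l\in L$ and $\alpha_l m_B(g_l(t))\neq0$. A finite minimal invariant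 set is a finite set that is minimal, with respect to inclusion, among the nonempty invariant sets. Let $\Omega(L)$ consist of the empty word and all finite words $l_0\dots l_k$ with $l_i\in L$ and $l_k\ne0$, and consider the family, indexed by $\Omega(L)$, $$\mathcal F=\left\{\Big(\prod_{i=0}^k\alpha_{l_i}\Big)e_{l_0+Rl_1+\dots+R^kl_k} : l_0\dots l_k\in\Omega(L)\right\}\subset L^2(\mu),$$ where the empty word gives the constant function $1$. (a) If $\{0\}$ is the only finite minimal invariant set, then the following condition holds: (iii) the only entire function $h$ on $\mathbb{C}$ such that $0\le h\le1$ on $\mathbb{R}$, $h(0)=1$ and $\sum_{l\in L}|\alpha_l|^2|m_B(g_l(t))|^2h(g_l(t))=h(t)$ for all $t\in\mathbb{R}$ is the constant function $1$; moreover, $\mathcal F$ is a Parseval frame for $L^2(\mu)$, that is, $\sum_{v\in\mathcal F}|\langle f,v\rangle|^2=\|f\|^2$ for all $f\in L^2(\mu)$, the sum being taken over the index set $\Omega(L)$. (b) Conversely, if $M\neq\{0\}$ is a finite minimal invariant set, then for every $c\in M$ the function $e_c$ is orthogonal to every element of $\mathcal F$ in $L^2(\mu)$; in particular, $\mathcal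 F$ is incomplete, i.e. its closed linear span is not $L^2(\mu)$. -/

import Mathlib

open MeasureTheory
open scoped ENNReal Matrix InnerProductSpace

noncomputable section

namespace WeightedFourier

/-- The maps `τ_b(x) = (x + b) / R` of the affine iterated function system. -/
def tau (R b : ℤ) (x : ℝ) : ℝ := (x + b) / R

/-- `μ` is a Borel probability measure with `μ(E) = (1/N) ∑_{b ∈ B} μ(τ_b⁻¹(E))`, `N = |B|`. -/
structure IsSelfAffineMeasure (R : ℤ) (B : Finset ℤ) (μ : Measure ℝ) : Prop where
  isProbabilityMeasure : IsProbabilityMeasure μ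
  invariance : ∀ E : Set ℝ, MeasurableSet E →
    μ E = (B.card : ℝ≥0∞)⁻¹ * ∑ b ∈ B, μ (tau R b ⁻¹' E)

open Classical in
/-- The self-affine measure `μ(R, B)`: the unique probability measure satisfying the invariance
equation. It exists and is unique when `|R| ≥ 2` and `B` is nonempty, see
`isSelfAffineMeasure_selfAffineMeasure` and `IsSelfAffineMeasure.eq_selfAffineMeasure`. -/
def selfAffineMeasure (R : ℤ) (B : Finset ℤ) : Measure ℝ :=
  if h : ∃ μ : Measure ℝ, IsSelfAffineMeasure R B μ then h.choose else 0

instance isFiniteMeasure_selfAffineMeasure (R : ℤ) (B : Finset ℤ) :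
    IsFiniteMeasure (selfAffineMeasure R B) := by
  unfold selfAffineMeasure
  split_ifs with h
  · have := h.choose_spec.isProbabilityMeasure
    infer_instance
  · infer_instance

section Existence

/-- The point of the attractor with digits `b`. -/
def coding (R : ℤ) (B : Finset ℤ) (b : ℕ → B) : ℝ := ∑' k, ((b k : ℤ) : ℝ) / (R : ℝ) ^ (k + 1)

lemma exists_digit_bound {R : ℤ} (hR : 2 ≤ |R|) (B : Finset ℤ) :
    ∃ u : ℕ → ℝ, Summable u ∧
      ∀ (k : ℕ) (b : B), ‖((b : ℤ) : ℝ) / (R : ℝ) ^ (k + 1)‖ ≤ u k := by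
  refine ⟨fun k => (∑ b ∈ B, |(b : ℝ)|) * (1 / 2 : ℝ) ^ (k + 1), ?_, ?_⟩
  · exact ((summable_nat_add_iff 1).2 summable_geometric_two).mul_left _
  · intro k b
    have h1 : |((b : ℤ) : ℝ)| ≤ ∑ b ∈ B, |(b : ℝ)| :=
      Finset.single_le_sum (f := fun b : ℤ => |(b : ℝ)|) (fun _ _ => abs_nonneg _) b.2
    have h2 : (2 : ℝ) ≤ |(R : ℝ)| := by exact_mod_cast hR
    change _ ≤ (∑ b ∈ B, |(b : ℝ)|) * (1 / 2 : ℝ) ^ (k + 1)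
    rw [norm_div, norm_pow, Real.norm_eq_abs, Real.norm_eq_abs, one_div, inv_pow, div_eq_mul_inv]
    gcongr

lemma summable_digits {R : ℤ} (hR : 2 ≤ |R|) (B : Finset ℤ) (b : ℕ → B) :
    Summable fun k => ((b k : ℤ) : ℝ) / (R : ℝ) ^ (k + 1) := by
  obtain ⟨u, hu, h⟩ := exists_digit_bound hR B
  exact Summable.of_norm_bounded hu fun k => h k (b k)

lemma continuous_coding {R : ℤ} (hR : 2 ≤ |R|) (B : Finset ℤ) : Continuous (coding R B) := by
  obtain ⟨u, hu, h⟩ := exists_digit_bound hR B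
  refine continuous_tsum (fun k => ?_) hu fun k b => h k (b k)
  exact (continuous_of_discreteTopology (f := fun c : B => ((c : ℤ) : ℝ) / (R : ℝ) ^ (k + 1))).comp
    (continuous_apply k)

/-- Prepend a digit to a sequence of digits. -/
def consDigit {B : Finset ℤ} (c : B) (b : ℕ → B) : ℕ → B
  | 0 => c
  | k + 1 => b k

lemma measurable_consDigit {B : Finset ℤ} (c : B) : Measurable (consDigit c) := by
  refine measurable_pi_lambda _ fun k => ?_
  cases k with
  | zero => exact measurable_const
  | succ k => exact measurable_pi_apply k

lemma coding_consDigit {R : ℤ} (hR : 2 ≤ |R|) {B : Finset ℤ} (c : B) (b : ℕ → B) :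
    coding R B (consDigit c b) = tau R c (coding R B b) := by
  have hR0 : (R : ℝ) ≠ 0 := by
    rintro h
    have : R = 0 := by exact_mod_cast h
    simp [this] at hR
  have h := (summable_digits hR B (consDigit c b)).tsum_eq_zero_add
  unfold coding tau
  rw [h, add_div, ← tsum_div_const, add_comm]
  congr 1
  · refine tsum_congr fun k => ?_
    simp only [consDigit]
    rw [div_div, ← pow_succ]
  · simp [consDigit]

/-- The uniform distribution on `B`. -/
def digitMeasure (B : Finset ℤ) : Measure B :=
  (B.card : ℝ≥0∞)⁻¹ • ∑ b : B, Measure.dirac b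

lemma isProbabilityMeasure_digitMeasure {B : Finset ℤ} (hB : B.Nonempty) :
    IsProbabilityMeasure (digitMeasure B) := by
  constructor
  have : (B.card : ℝ≥0∞) ≠ 0 := by simpa using hB.ne_empty
  simp [digitMeasure, ENNReal.inv_mul_cancel this (ENNReal.natCast_ne_top _)]

lemma infinitePi_consDigit {B : Finset ℤ} [IsProbabilityMeasure (digitMeasure B)] :
    (B.card : ℝ≥0∞)⁻¹ •
      ∑ c : B, (Measure.infinitePi fun _ : ℕ => digitMeasure B).map (consDigit c) =
    Measure.infinitePi fun _ : ℕ => digitMeasure B := by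
  classical
  refine Measure.eq_infinitePi _ fun s t ht => ?_
  obtain ⟨n, hn⟩ : ∃ n, s ⊆ Finset.range (n + 1) :=
    ⟨s.sup id, fun i hi => Finset.mem_range.2 (Nat.lt_succ_of_le (Finset.le_sup (f := id) hi))⟩
  set t' : ℕ → Set B := fun i => if i ∈ s then t i else Set.univ with ht'
  have hm : ∀ i, MeasurableSet (t' i) := fun i => Set.Finite.measurableSet (Set.toFinite _)
  have hpi : Set.pi (s : Set ℕ) t = Set.pi (Finset.range (n + 1) : Set ℕ) t' := by
    ext x
    simp only [Set.mem_pi, ht', Finset.mem_coe]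
    constructor
    · intro h i _
      split_ifs with hi
      · exact h i hi
      · trivial
    · intro h i hi
      have := h i (hn hi)
      rwa [if_pos hi] at this
  have hprod : ∏ i ∈ s, digitMeasure B (t i) =
      ∏ i ∈ Finset.range (n + 1), digitMeasure B (t' i) := by
    rw [← Finset.prod_subset hn (f := fun i => digitMeasure B (t' i))]
    · exact Finset.prod_congr rfl fun i hi => by simp [ht', hi]
    · intro i _ hi
      simp [ht', hi]
  have hpre : ∀ c : B, (Measure.infinitePi fun _ : ℕ => digitMeasure B).map (consDigit c)
      (Set.pi (Finset.range (n + 1) : Set ℕ) t') =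
      Measure.dirac c (t' 0) * ∏ i ∈ Finset.range n, digitMeasure B (t' (i + 1)) := by
    intro c
    rw [Measure.map_apply (measurable_consDigit c)
      (MeasurableSet.pi (Finset.countable_toSet _) fun i _ => hm i),
      Measure.dirac_apply' _ (hm 0)]
    by_cases hc : c ∈ t' 0
    · have : consDigit c ⁻¹' Set.pi (Finset.range (n + 1) : Set ℕ) t' =
          Set.pi (Finset.range n : Set ℕ) fun i => t' (i + 1) := by
        ext x
        simp only [Set.mem_preimage, Set.mem_pi, Finset.mem_coe, Finset.mem_range]
        constructor
        · intro h i hi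
          exact h (i + 1) (by omega)
        · rintro h (_ | i) hi
          · exact hc
          · exact h i (by omega)
      rw [this, Measure.infinitePi_pi _ fun i _ => hm (i + 1)]
      simp [hc]
    · have : consDigit c ⁻¹' Set.pi (Finset.range (n + 1) : Set ℕ) t' = ∅ := by
        ext x
        simp only [Set.mem_preimage, Set.mem_pi, Finset.mem_coe, Finset.mem_range,
          Set.mem_empty_iff_false, iff_false]
        exact fun h => hc (h 0 (by omega))
      rw [this]
      simp [hc]
  rw [hpi, hprod, Finset.prod_range_succ', Measure.smul_apply, Measure.finsetSum_apply,
    Finset.sum_congr rfl fun c _ => hpre c, ← Finset.sum_mul, smul_eq_mul, ← mul_assoc, mul_comm]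
  congr 1
  simp only [digitMeasure, Measure.smul_apply, Measure.finsetSum_apply, smul_eq_mul]

lemma exists_isSelfAffineMeasure {R : ℤ} (hR : 2 ≤ |R|) {B : Finset ℤ} (hB : B.Nonempty) :
    ∃ μ : Measure ℝ, IsSelfAffineMeasure R B μ := by
  have := isProbabilityMeasure_digitMeasure hB
  have hm : Measurable (coding R B) := (continuous_coding hR B).measurable
  have ht : ∀ c, Measurable (tau R c) := fun c => by unfold tau; fun_prop
  refine ⟨(Measure.infinitePi fun _ : ℕ => digitMeasure B).map (coding R B),
    Measure.isProbabilityMeasure_map hm.aemeasurable, fun E hE => ?_⟩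
  conv_lhs => rw [← infinitePi_consDigit, Measure.map_apply hm hE]
  rw [Measure.smul_apply, Measure.finsetSum_apply, smul_eq_mul, ← Finset.sum_coe_sort B]
  congr 1
  refine Finset.sum_congr rfl fun c _ => ?_
  rw [Measure.map_apply (measurable_consDigit c) (hm hE), Measure.map_apply hm (ht c hE)]
  congr 1
  ext b
  simp [coding_consDigit hR]

theorem isSelfAffineMeasure_selfAffineMeasure {R : ℤ} (hR : 2 ≤ |R|) {B : Finset ℤ}
    (hB : B.Nonempty) : IsSelfAffineMeasure R B (selfAffineMeasure R B) := by
  have h := exists_isSelfAffineMeasure hR hB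
  rw [selfAffineMeasure, dif_pos h]
  exact h.choose_spec

lemma IsSelfAffineMeasure.charFun_eq {R : ℤ} {B : Finset ℤ} {μ : Measure ℝ}
    (h : IsSelfAffineMeasure R B μ) (t : ℝ) :
    charFun μ t = ((B.card : ℂ)⁻¹ * ∑ b ∈ B, Complex.exp (t * b / R * Complex.I)) *
      charFun μ (t / R) := by
  have := h.isProbabilityMeasure
  have ht : ∀ c, Measurable (tau R c) := fun c => by unfold tau; fun_prop
  have hμ : μ = (B.card : ℝ≥0∞)⁻¹ • ∑ b ∈ B, μ.map (tau R b) := by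
    ext E hE
    rw [h.invariance E hE, Measure.smul_apply, Measure.finsetSum_apply, smul_eq_mul]
    congr 1
    exact Finset.sum_congr rfl fun b _ => (Measure.map_apply (ht b) hE).symm
  have hint : ∀ b ∈ B, Integrable (fun x : ℝ => Complex.exp (t * x * Complex.I))
      (μ.map (tau R b)) := by
    intro b _
    have := Measure.isProbabilityMeasure_map (μ := μ) (ht b).aemeasurable
    refine Integrable.of_bound (C := 1) (by fun_prop) (Filter.Eventually.of_forall fun x => ?_)
    rw [← Complex.ofReal_mul, Complex.norm_exp_ofReal_mul_I]
  rw [charFun_apply_real, charFun_apply_real]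
  conv_lhs => rw [hμ]
  rw [integral_smul_measure, integral_finsetSum_measure hint]
  simp only [ENNReal.toReal_inv, ENNReal.toReal_natCast]
  rw [mul_assoc, Finset.sum_mul, Complex.real_smul]
  push_cast
  congr 1
  refine Finset.sum_congr rfl fun b _ => ?_
  rw [integral_map (ht b).aemeasurable (by fun_prop), ← integral_const_mul]
  congr 1
  ext x
  rw [← Complex.exp_add]
  congr 1
  simp only [tau]
  push_cast
  ring

theorem IsSelfAffineMeasure.unique {R : ℤ} (hR : 2 ≤ |R|) {B : Finset ℤ} {μ ν : Measure ℝ}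
    (hμ : IsSelfAffineMeasure R B μ) (hν : IsSelfAffineMeasure R B ν) : μ = ν := by
  have := hμ.isProbabilityMeasure
  have := hν.isProbabilityMeasure
  have h2 : (2 : ℝ) ≤ |(R : ℝ)| := by exact_mod_cast hR
  refine Measure.ext_of_charFun (funext fun t => ?_)
  set d : ℝ → ℝ := fun t => ‖charFun μ t - charFun ν t‖ with hd
  have hle : ∀ t, d t ≤ d (t / R) := by
    intro t
    simp only [hd]
    rw [hμ.charFun_eq t, hν.charFun_eq t, ← mul_sub, norm_mul]
    refine mul_le_of_le_one_left (norm_nonneg _) ?_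
    rw [norm_mul, norm_inv, Complex.norm_natCast]
    have hs : ‖∑ b ∈ B, Complex.exp (t * b / R * Complex.I)‖ ≤ B.card := by
      refine (norm_sum_le _ _).trans ?_
      rw [Finset.card_eq_sum_ones, Nat.cast_sum]
      refine Finset.sum_le_sum fun b _ => ?_
      have : (t * b / R * Complex.I : ℂ) = ((t * b / R : ℝ) : ℂ) * Complex.I := by push_cast; rfl
      rw [this, Complex.norm_exp_ofReal_mul_I, Nat.cast_one]
    rcases Nat.eq_zero_or_pos B.card with h0 | h0
    · simp [h0]
    · rw [inv_mul_le_iff₀ (by exact_mod_cast h0), mul_one]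
      exact hs
  have hit : ∀ n : ℕ, d t ≤ d (t / (R : ℝ) ^ n) := by
    intro n
    induction n with
    | zero => simp
    | succ n ih =>
      refine ih.trans ((hle _).trans_eq ?_)
      rw [div_div, ← pow_succ]
  have hcont : Continuous d := by
    have h1 : Continuous (charFun μ) := by fun_prop
    have h2 : Continuous (charFun ν) := by fun_prop
    exact (h1.sub h2).norm
  have hlim : Filter.Tendsto (fun n : ℕ => t / (R : ℝ) ^ n) Filter.atTop (nhds 0) := by
    have : Filter.Tendsto (fun n : ℕ => t * ((R : ℝ)⁻¹) ^ n) Filter.atTop (nhds (t * 0)) := by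
      refine (tendsto_pow_atTop_nhds_zero_of_abs_lt_one ?_).const_mul t
      rw [abs_inv]
      exact inv_lt_one_of_one_lt₀ (by linarith)
    simpa [div_eq_mul_inv] using this
  have h0 : d 0 = 0 := by simp [hd]
  have hfin : d t ≤ 0 := by
    have := (hcont.tendsto 0).comp hlim
    rw [h0] at this
    exact ge_of_tendsto' this hit
  exact sub_eq_zero.1 (norm_le_zero_iff.1 hfin)

theorem IsSelfAffineMeasure.eq_selfAffineMeasure {R : ℤ} (hR : 2 ≤ |R|) {B : Finset ℤ}
    (hB : B.Nonempty) {μ : Measure ℝ} (hμ : IsSelfAffineMeasure R B μ) :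
    μ = selfAffineMeasure R B :=
  hμ.unique hR (isSelfAffineMeasure_selfAffineMeasure hR hB)

end Existence

/-- The attractor `X_B = {∑_{k ≥ 1} R⁻ᵏ b_k : b_k ∈ B}`. -/
def attractor (R : ℤ) (B : Finset ℤ) : Set ℝ :=
  {x | ∃ b : ℕ → ℤ, (∀ k, b k ∈ B) ∧ HasSum (fun k => (b k : ℝ) / (R : ℝ) ^ (k + 1)) x}

/-- The no overlap condition: `μ(τ_b(X_B) ∩ τ_{b'}(X_B)) = 0` for `b ≠ b'` in `B`. -/
def NoOverlap (R : ℤ) (B : Finset ℤ) : Prop :=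
  ∀ b ∈ B, ∀ b' ∈ B, b ≠ b' →
    selfAffineMeasure R B (tau R b '' attractor R B ∩ tau R b' '' attractor R B) = 0

/-- `m_B(x) = (1/N) ∑_{b ∈ B} e^{2πi b x}`. -/
def mB (B : Finset ℤ) (x : ℝ) : ℂ :=
  (1 / (B.card : ℂ)) * ∑ b ∈ B, Complex.exp (2 * Real.pi * Complex.I * b * x)

/-- The maps `g_l(t) = (t - l) / R`. -/
def g (R l : ℤ) (t : ℝ) : ℝ := (t - l) / R

/-- The matrix `T = N^{-1/2} (e^{2πi R⁻¹ l b} α_l)`, rows indexed by `L`, columns by `B`. -/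
def matT (R : ℤ) (B L : Finset ℤ) (α : ℤ → ℂ) : Matrix L B ℂ :=
  Matrix.of fun l b => (1 / (Real.sqrt B.card : ℂ)) *
    (Complex.exp (2 * Real.pi * Complex.I * ((l : ℤ) * (b : ℤ) / R)) * α l)

/-- `h` is entire, `0 ≤ h ≤ 1` on `ℝ`, `h(0) = 1`, and
`∑_{l ∈ L} |α_l|² |m_B(g_l(t))|² h(g_l(t)) = h(t)` for all real `t`. -/
structure IsHarmonic (R : ℤ) (B L : Finset ℤ) (α : ℤ → ℂ) (h : ℂ → ℂ) : Prop where
  entire : Differentiable ℂ h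
  real_on_reals : ∀ t : ℝ, (h t).im = 0
  bounds : ∀ t : ℝ, 0 ≤ (h t).re ∧ (h t).re ≤ 1
  at_zero : h 0 = 1
  fixed : ∀ t : ℝ,
    ∑ l ∈ L, ((‖α l‖ ^ 2 * ‖mB B (g R l t)‖ ^ 2 : ℝ) : ℂ) * h (g R l t : ℝ) = h t

/-- The only function as in `IsHarmonic` is the constant function `1`. -/
def OnlyConstantHarmonic (R : ℤ) (B L : Finset ℤ) (α : ℤ → ℂ) : Prop :=
  ∀ h : ℂ → ℂ, IsHarmonic R B L α h ↔ h = fun _ => 1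

/-- `M` is invariant: it contains every point `g_l(t)`, `t ∈ M`, `l ∈ L`, such that the
transition `t → g_l(t)` is possible, that is, `α_l m_B(g_l(t)) ≠ 0`. -/
def IsInvariant (R : ℤ) (B L : Finset ℤ) (α : ℤ → ℂ) (M : Set ℝ) : Prop :=
  ∀ t ∈ M, ∀ l ∈ L, α l * mB B (g R l t) ≠ 0 → g R l t ∈ M

/-- `M` is a finite minimal invariant set: finite, and minimal with respect to inclusion among
the nonempty invariant sets. -/
def IsFiniteMinimalInvariant (R : ℤ) (B L : Finset ℤ) (α : ℤ → ℂ) (M : Set ℝ) : Prop :=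
  M.Finite ∧ Minimal (fun S : Set ℝ => S.Nonempty ∧ IsInvariant R B L α S) M

/-- `Ω(L)`: the empty word and the finite words with digits in `L` whose last digit is not `0`. -/
def Words (L : Finset ℤ) : Type :=
  {w : List ℤ // (∀ l ∈ w, l ∈ L) ∧ ∀ l ∈ w.getLast?, l ≠ 0}

/-- The frequency `l₀ + R l₁ + ⋯ + Rᵏ l_k` of the word `l₀ l₁ … l_k`; `0` for the empty word. -/
def freq (R : ℤ) : List ℤ → ℤ
  | [] => 0
  | l :: w => l + R * freq R w

/-- The exponential `e_t(x) = e^{2πi t x}` as an element of `L²(μ)`. -/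
def expL2 (μ : Measure ℝ) [IsFiniteMeasure μ] (t : ℝ) : Lp ℂ 2 μ :=
  MemLp.toLp (fun x : ℝ => Complex.exp (2 * Real.pi * Complex.I * t * x))
    (MemLp.of_bound (by fun_prop) 1 (Filter.Eventually.of_forall fun x => by
      have : (2 * Real.pi * Complex.I * t * x : ℂ) =
          ((2 * Real.pi * t * x : ℝ) : ℂ) * Complex.I := by push_cast; ring
      rw [this, Complex.norm_exp_ofReal_mul_I]))

/-- The weighted exponentials `(∏ α_{l_i}) e_{l₀ + R l₁ + ⋯ + Rᵏ l_k}` in `L²(μ(R, B))`, indexed by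
the words in `Ω(L)`; the empty word gives the constant function `1`. -/
def weightedExp (R : ℤ) (B L : Finset ℤ) (α : ℤ → ℂ) (w : Words L) :
    Lp ℂ 2 (selfAffineMeasure R B) :=
  (w.1.map α).prod • expL2 (selfAffineMeasure R B) (freq R w.1 : ℝ)

/-- A Parseval frame: a frame with both frame bounds `1`. -/
def IsParsevalFrame {ι H : Type*} [NormedAddCommGroup H] [InnerProductSpace ℂ H]
    (v : ι → H) : Prop :=
  ∀ f : H, HasSum (fun i => ‖inner ℂ (v i) f‖ ^ 2) (‖f‖ ^ 2)

end WeightedFourier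

end

noncomputable section

namespace WeightedFourier

/-! ### Integration against a self-affine measure -/

/-! Everything runs through the operators `transfer`, one for each digit `l`. The isometry `T^*T =
I` gives `∑ l, ‖transfer l f‖² = ‖f‖²` in `L²(μ)` (`sum_integral_norm_sq_transfer`), and the
coefficient of `f` at a word `l :: w` is the coefficient of `transfer l f` at `w` (`coeff_cons`).
Peeling letters off words therefore yields the Bessel inequality with bound 1
(`sum_norm_coeff_sq_le`). On exponentials, `transfer l` sends `e_t` to `conj α_l · m_B(g_l t) ·
e_{g_l t}` (`transfer_expo`), so the coefficients follow a random walk `t → g_l t` with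
probabilities `|α_l m_B(g_l t)|²`.

For (a), `energy`, the sum of the squared coefficients of `e_t`, is harmonic for this walk, at most
1, and equal to 1 at 0. It is real analytic because `μ` has bounded support (`contDiff_expL2`). The
minimum principle `eq_one_of_analytic` applies: on a compact interval preserved by all `g_l`, the
minimizers form an invariant set. If that set is infinite, the identity theorem makes the function
constant; if finite, it contains a minimal invariant set, hence 0, so the minimum is 1. The same
principle gives (iii). Parseval then holds on the exponentials, which are total, and extends to
`L²(μ)` by `isParsevalFrame_of_total`.

For (b), a finite minimal invariant `M ≠ {0}` avoids 0. The walk from `c ∈ M` stays in `M`, and the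
Fourier transform of `μ` vanishes on `M`, since otherwise `M` would contain all `c / R^n`
(`coeff_nil_expo_eq_zero`). Hence every coefficient of `e_c` is 0. -/

lemma measurable_tau (R b : ℤ) : Measurable (tau R b) := by unfold tau; fun_prop

lemma IsSelfAffineMeasure.eq_smul_sum_map {R : ℤ} {B : Finset ℤ} {μ : Measure ℝ}
    (h : IsSelfAffineMeasure R B μ) :
    μ = (B.card : ℝ≥0∞)⁻¹ • ∑ b ∈ B, μ.map (tau R b) := by
  ext E hE
  rw [h.invariance E hE, Measure.smul_apply, Measure.finsetSum_apply, smul_eq_mul]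
  congr 1
  exact Finset.sum_congr rfl fun b _ => (Measure.map_apply (measurable_tau R b) hE).symm

/-- A single term of the average defining `μ` is dominated by `N` times the whole; this is what lets
integrability pass to compositions with `τ_b`. -/
lemma IsSelfAffineMeasure.map_tau_le {R : ℤ} {B : Finset ℤ} {μ : Measure ℝ}
    (h : IsSelfAffineMeasure R B μ) {b : ℤ} (hb : b ∈ B) :
    μ.map (tau R b) ≤ (B.card : ℝ≥0∞) • μ := by
  have hN : (B.card : ℝ≥0∞) ≠ 0 := by
    simpa using Finset.ne_empty_of_mem hb
  refine Measure.le_iff.2 fun E hE => ?_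
  rw [Measure.smul_apply, smul_eq_mul, h.invariance E hE, ← mul_assoc,
    ENNReal.mul_inv_cancel hN (ENNReal.natCast_ne_top _), one_mul,
    Measure.map_apply (measurable_tau R b) hE]
  exact Finset.single_le_sum (f := fun b => μ (tau R b ⁻¹' E)) (fun _ _ => zero_le) hb

lemma IsSelfAffineMeasure.memLp_comp_tau {R : ℤ} {B : Finset ℤ} {μ : Measure ℝ}
    (h : IsSelfAffineMeasure R B μ) {b : ℤ} (hb : b ∈ B) {p : ℝ≥0∞} {f : ℝ → ℂ}
    (hf : MemLp f p μ) : MemLp (fun x => f (tau R b x)) p μ :=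
  (hf.of_measure_le_smul (ENNReal.natCast_ne_top _) (h.map_tau_le hb)).comp_of_map
    (measurable_tau R b).aemeasurable

lemma IsSelfAffineMeasure.integral_eq {R : ℤ} {B : Finset ℤ} {μ : Measure ℝ}
    (h : IsSelfAffineMeasure R B μ) {E : Type*} [NormedAddCommGroup E] [NormedSpace ℝ E]
    {f : ℝ → E} (hf : Integrable f μ) :
    ∫ x, f x ∂μ = (B.card : ℝ)⁻¹ • ∑ b ∈ B, ∫ x, f (tau R b x) ∂μ := by
  have hint : ∀ b ∈ B, Integrable f (μ.map (tau R b)) := fun b hb =>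
    hf.of_measure_le_smul (ENNReal.natCast_ne_top _) (h.map_tau_le hb)
  conv_lhs => rw [h.eq_smul_sum_map]
  rw [integral_smul_measure, integral_finsetSum_measure hint, ENNReal.toReal_inv,
    ENNReal.toReal_natCast]
  congr 1
  exact Finset.sum_congr rfl fun b hb =>
    integral_map (measurable_tau R b).aemeasurable (hint b hb).aestronglyMeasurable

/-! ### Exponentials -/

/-- The exponential `e_t(x) = e^{2πi t x}`. -/
def expo (t x : ℝ) : ℂ := Complex.exp (2 * Real.pi * Complex.I * t * x)

lemma expo_eq (t x : ℝ) : expo t x = Complex.exp (((2 * Real.pi * t * x : ℝ) : ℂ) * Complex.I) := by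
  unfold expo
  congr 1
  push_cast
  ring

@[simp] lemma norm_expo (t x : ℝ) : ‖expo t x‖ = 1 := by
  rw [expo_eq, Complex.norm_exp_ofReal_mul_I]

lemma continuous_expo (t : ℝ) : Continuous (expo t) := by unfold expo; fun_prop

lemma star_expo (t x : ℝ) : (starRingEnd ℂ) (expo t x) = expo (-t) x := by
  rw [expo_eq, expo_eq, ← Complex.exp_conj]
  congr 1
  rw [map_mul, Complex.conj_ofReal, Complex.conj_I]
  push_cast
  ring

lemma expo_add_left (s t x : ℝ) : expo (s + t) x = expo s x * expo t x := by
  unfold expo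
  rw [← Complex.exp_add]
  congr 1
  push_cast
  ring

lemma expo_add_right (t x y : ℝ) : expo t (x + y) = expo t x * expo t y := by
  unfold expo
  rw [← Complex.exp_add]
  congr 1
  push_cast
  ring

@[simp] lemma expo_zero_left (x : ℝ) : expo 0 x = 1 := by simp [expo]

lemma expo_intCast (m n : ℤ) : expo m n = 1 := by
  unfold expo
  rw [show (2 * Real.pi * Complex.I * (m : ℝ) * (n : ℝ) : ℂ) =
    ((m * n : ℤ) : ℂ) * (2 * Real.pi * Complex.I) by push_cast; ring]
  exact Complex.exp_int_mul_two_pi_mul_I _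

lemma memLp_expo (μ : Measure ℝ) [IsFiniteMeasure μ] (t : ℝ) (p : ℝ≥0∞) : MemLp (expo t) p μ :=
  MemLp.of_bound (continuous_expo t).aestronglyMeasurable 1
    (Filter.Eventually.of_forall fun x => (norm_expo t x).le)

lemma coeFn_expL2 (μ : Measure ℝ) [IsFiniteMeasure μ] (t : ℝ) : expL2 μ t =ᵐ[μ] expo t :=
  MemLp.coeFn_toLp _

lemma mB_eq (B : Finset ℤ) (x : ℝ) : mB B x = (B.card : ℂ)⁻¹ * ∑ b ∈ B, expo x b := by
  unfold mB expo
  rw [one_div]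
  congr 1
  refine Finset.sum_congr rfl fun b _ => ?_
  congr 1
  push_cast
  ring

/-! ### The transfer operators -/

/-- The operator `f ↦ \bar α_l (1/N) ∑_{b ∈ B} (e_{-l} f) ∘ τ_b`, the adjoint of
`f ↦ α_l e_l · (f ∘ 𝓡)` with `𝓡` the left inverse of the maps `τ_b`. -/
def transfer (R : ℤ) (B : Finset ℤ) (α : ℤ → ℂ) (l : ℤ) (f : ℝ → ℂ) (x : ℝ) : ℂ :=
  (starRingEnd ℂ) (α l) * ((B.card : ℂ)⁻¹ * ∑ b ∈ B, expo (-l) (tau R b x) * f (tau R b x))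

lemma sum_norm_sq_matT {R : ℤ} {B L : Finset ℤ} {α : ℤ → ℂ}
    (hT : (matT R B L α)ᴴ * matT R B L α = 1) (v : B → ℂ) :
    ∑ l : L, ‖(matT R B L α *ᵥ v) l‖ ^ 2 = ∑ b : B, ‖v b‖ ^ 2 := by
  have h : star (matT R B L α *ᵥ v) ⬝ᵥ (matT R B L α *ᵥ v) = star v ⬝ᵥ v := by
    rw [Matrix.star_mulVec, Matrix.dotProduct_mulVec, Matrix.vecMul_vecMul, hT, Matrix.vecMul_one]
  have key : ∀ {ι : Type} [Fintype ι] (u : ι → ℂ),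
      star u ⬝ᵥ u = ((∑ i, ‖u i‖ ^ 2 : ℝ) : ℂ) := by
    intro ι _ u
    simp only [dotProduct, Pi.star_apply, RCLike.star_def, Complex.conj_mul']
    push_cast
    rfl
  rw [key, key] at h
  exact_mod_cast h

/-- Since `l τ_b(x) = l x / R + l b / R`, the conjugates of the numbers `transfer l f x` are, up to
the unimodular factor `e_{l/R}(x)`, the entries of `T` applied to the vector `N^{-1/2} conj f(τ_b
x)`. The isometry of `T` does the rest. -/
lemma sum_norm_sq_transfer {R : ℤ} (hR : R ≠ 0) {B L : Finset ℤ} {α : ℤ → ℂ}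
    (hT : (matT R B L α)ᴴ * matT R B L α = 1) (f : ℝ → ℂ) (x : ℝ) :
    ∑ l ∈ L, ‖transfer R B α l f x‖ ^ 2 = (B.card : ℝ)⁻¹ * ∑ b ∈ B, ‖f (tau R b x)‖ ^ 2 := by
  set s : ℂ := 1 / (Real.sqrt B.card : ℂ) with hs
  have hs2 : s * s = (B.card : ℂ)⁻¹ := by
    rw [hs, div_mul_div_comm, one_mul, ← Complex.ofReal_mul,
      Real.mul_self_sqrt (Nat.cast_nonneg _)]
    simp
  have hsn : ‖s‖ ^ 2 = (B.card : ℝ)⁻¹ := by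
    rw [sq, ← norm_mul, hs2]
    simp
  have hsc : (starRingEnd ℂ) s = s := by simp [hs]
  have h := sum_norm_sq_matT hT fun b => s * (starRingEnd ℂ) (f (tau R b x))
  have hR' : (R : ℂ) ≠ 0 := by exact_mod_cast hR
  have hl : ∀ l : L, ‖(matT R B L α *ᵥ fun b => s * (starRingEnd ℂ) (f (tau R b x))) l‖ =
      ‖transfer R B α l f x‖ := by
    intro l
    have e : (starRingEnd ℂ) (transfer R B α l f x) = expo (l / R) x *
        (matT R B L α *ᵥ fun b => s * (starRingEnd ℂ) (f (tau R b x))) l := by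
      simp only [transfer, Matrix.mulVec, dotProduct, matT, Matrix.of_apply, map_mul, map_sum,
        Complex.conj_conj, star_expo, map_inv₀, map_natCast, neg_neg, ← hs]
      rw [← hs2, ← Finset.sum_coe_sort B]
      simp only [Finset.mul_sum]
      refine Finset.sum_congr rfl fun b _ => ?_
      have : expo (l : ℤ) (tau R b x) = expo (l / R) x *
          Complex.exp (2 * Real.pi * Complex.I * ((l : ℤ) * (b : ℤ) / R)) := by
        unfold expo tau
        rw [← Complex.exp_add]
        congr 1
        push_cast
        field_simp
      rw [this]
      ring
    rw [← RCLike.norm_conj (transfer R B α l f x), e, norm_mul, norm_expo, one_mul]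
  simp only [hl, norm_mul, mul_pow, hsn, RCLike.norm_conj] at h
  rw [Finset.sum_coe_sort L fun l => ‖transfer R B α l f x‖ ^ 2, ← Finset.mul_sum,
    Finset.sum_coe_sort B fun b => ‖f (tau R b x)‖ ^ 2] at h
  exact h

/-- Because `(t - l) τ_b(x) = g_l(t) (x + b)`, the factor depending on `x` leaves the sum over `b`,
and what remains is `m_B(g_l t)`. -/
lemma transfer_expo {R : ℤ} (hR : R ≠ 0) (B : Finset ℤ) (α : ℤ → ℂ) (l : ℤ) (t x : ℝ) :
    transfer R B α l (expo t) x =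
      (starRingEnd ℂ) (α l) * mB B (g R l t) * expo (g R l t) x := by
  have hR' : (R : ℝ) ≠ 0 := by exact_mod_cast hR
  unfold transfer
  rw [mB_eq, mul_assoc, mul_assoc, Finset.sum_mul]
  congr 2
  refine Finset.sum_congr rfl fun b _ => ?_
  rw [← expo_add_left, ← expo_add_right]
  unfold expo tau g
  congr 1
  have hR'' : (R : ℂ) ≠ 0 := by exact_mod_cast hR
  push_cast
  field_simp
  ring

/-- The transition probabilities add up to one. -/
lemma sum_transition {R : ℤ} (hR : R ≠ 0) {B L : Finset ℤ} (hB : B.Nonempty) {α : ℤ → ℂ}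
    (hT : (matT R B L α)ᴴ * matT R B L α = 1) (t : ℝ) :
    ∑ l ∈ L, ‖α l‖ ^ 2 * ‖mB B (g R l t)‖ ^ 2 = 1 := by
  -- For `f = e_t` every modulus on the right is 1, so the point of evaluation is arbitrary.
  have h := sum_norm_sq_transfer hR hT (expo t) 0
  simp only [transfer_expo hR, norm_mul, norm_expo, RCLike.norm_conj, mul_one, mul_pow, one_pow,
    Finset.sum_const, nsmul_eq_mul] at h
  rw [h, inv_mul_cancel₀]
  exact_mod_cast hB.card_pos.ne'

lemma IsSelfAffineMeasure.memLp_transfer {R : ℤ} {B : Finset ℤ} {μ : Measure ℝ}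
    (h : IsSelfAffineMeasure R B μ) (α : ℤ → ℂ) (l : ℤ) {f : ℝ → ℂ} (hf : MemLp f 2 μ) :
    MemLp (transfer R B α l f) 2 μ := by
  have hb : ∀ b ∈ B, MemLp (fun x => expo (-l) (tau R b x) * f (tau R b x)) 2 μ := by
    intro b hb
    have hc : Continuous fun x => expo (-l) (tau R b x) :=
      (continuous_expo _).comp (by unfold tau; fun_prop)
    refine (h.memLp_comp_tau hb hf).of_le (hc.aestronglyMeasurable.mul
      (h.memLp_comp_tau hb hf).aestronglyMeasurable) (Filter.Eventually.of_forall fun x => ?_)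
    rw [norm_mul, norm_expo, one_mul]
  exact ((memLp_finsetSum B hb).const_mul _).const_mul _

lemma IsSelfAffineMeasure.sum_integral_norm_sq_transfer {R : ℤ} (hR : R ≠ 0) {B L : Finset ℤ}
    {μ : Measure ℝ} (h : IsSelfAffineMeasure R B μ) {α : ℤ → ℂ}
    (hT : (matT R B L α)ᴴ * matT R B L α = 1) {f : ℝ → ℂ} (hf : MemLp f 2 μ) :
    ∑ l ∈ L, ∫ x, ‖transfer R B α l f x‖ ^ 2 ∂μ = ∫ x, ‖f x‖ ^ 2 ∂μ := by
  have hsq : ∀ {k : ℝ → ℂ}, MemLp k 2 μ → Integrable (fun x => ‖k x‖ ^ 2) μ := fun hk =>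
    (memLp_two_iff_integrable_sq_norm hk.aestronglyMeasurable).1 hk
  rw [← integral_finsetSum _ fun l _ => hsq (h.memLp_transfer α l hf)]
  simp only [sum_norm_sq_transfer hR hT]
  rw [integral_const_mul, integral_finsetSum _ fun b hb => hsq (h.memLp_comp_tau hb hf),
    h.integral_eq (hsq hf), smul_eq_mul]

/-! ### Frame coefficients -/

/-- The coefficient `⟨v_w, f⟩` of `f` with respect to the weighted exponential of the word `w`. -/
def coeff (R : ℤ) (α : ℤ → ℂ) (μ : Measure ℝ) (w : List ℤ) (f : ℝ → ℂ) : ℂ :=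
  (starRingEnd ℂ) (w.map α).prod * ∫ x, expo (-(freq R w : ℝ)) x * f x ∂μ

/-- The adjoint relation tested on integer frequencies: `(l + R n) τ_b(x) = l τ_b(x) + n x + n b`,
and `e_n(b) = 1` because `n b` is an integer. -/
lemma IsSelfAffineMeasure.integral_expo_transfer {R : ℤ} (hR : R ≠ 0) {B : Finset ℤ}
    {μ : Measure ℝ} (h : IsSelfAffineMeasure R B μ) (α : ℤ → ℂ) (l n : ℤ) {f : ℝ → ℂ}
    (hf : MemLp f 2 μ) :
    ∫ x, expo (-(n : ℝ)) x * transfer R B α l f x ∂μ =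
      (starRingEnd ℂ) (α l) * ∫ x, expo (-((l + R * n : ℤ) : ℝ)) x * f x ∂μ := by
  have := h.isProbabilityMeasure
  have hR' : (R : ℂ) ≠ 0 := by exact_mod_cast hR
  have hint : ∀ (t : ℝ) {k : ℝ → ℂ}, MemLp k 2 μ → Integrable (fun x => expo t x * k x) μ :=
    fun t k hk => (hk.integrable one_le_two).bdd_mul (c := 1)
      (continuous_expo t).aestronglyMeasurable (Filter.Eventually.of_forall fun x => by simp)
  have hm : MemLp (fun x => expo (-((l + R * n : ℤ) : ℝ)) x * f x) 2 μ :=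
    hf.of_le ((continuous_expo _).aestronglyMeasurable.mul hf.aestronglyMeasurable)
      (Filter.Eventually.of_forall fun x => by simp)
  rw [h.integral_eq (hint _ hf), ← integral_finsetSum _ fun b hb =>
    (h.memLp_comp_tau hb hm).integrable one_le_two]
  rw [Complex.real_smul, ← integral_const_mul, ← integral_const_mul]
  refine integral_congr_ae (Filter.Eventually.of_forall fun x => ?_)
  simp only [transfer]
  rw [mul_left_comm, Complex.ofReal_inv, Complex.ofReal_natCast, mul_left_comm (expo _ _),
    Finset.mul_sum]
  congr 2
  refine Finset.sum_congr rfl fun b _ => ?_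
  rw [← mul_assoc]
  congr 1
  have e : expo (-((l + R * n : ℤ) : ℝ)) (tau R b x) =
      expo (-n : ℝ) x * expo (-l) (tau R b x) * expo ((-n : ℤ) : ℝ) b := by
    unfold expo tau
    rw [← Complex.exp_add, ← Complex.exp_add]
    congr 1
    push_cast
    field_simp
    ring
  rw [e, expo_intCast, mul_one]

lemma IsSelfAffineMeasure.coeff_cons {R : ℤ} (hR : R ≠ 0) {B : Finset ℤ}
    {μ : Measure ℝ} (h : IsSelfAffineMeasure R B μ) (α : ℤ → ℂ) (l : ℤ) (w : List ℤ) {f : ℝ → ℂ}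
    (hf : MemLp f 2 μ) :
    coeff R α μ (l :: w) f = coeff R α μ w (transfer R B α l f) := by
  unfold coeff
  rw [h.integral_expo_transfer hR α l (freq R w) hf, List.map_cons, List.prod_cons, map_mul, freq]
  ring

lemma coeff_const_mul (R : ℤ) (α : ℤ → ℂ) (μ : Measure ℝ) (w : List ℤ) (c : ℂ) (f : ℝ → ℂ) :
    coeff R α μ w (fun x => c * f x) = c * coeff R α μ w f := by
  unfold coeff
  simp only [mul_left_comm _ c, integral_const_mul]

lemma IsSelfAffineMeasure.coeff_cons_expo {R : ℤ} (hR : R ≠ 0) {B : Finset ℤ}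
    {μ : Measure ℝ} (h : IsSelfAffineMeasure R B μ) (α : ℤ → ℂ) (l : ℤ) (w : List ℤ) (t : ℝ) :
    coeff R α μ (l :: w) (expo t) =
      (starRingEnd ℂ) (α l) * mB B (g R l t) * coeff R α μ w (expo (g R l t)) := by
  have := h.isProbabilityMeasure
  rw [h.coeff_cons hR α l w (memLp_expo μ t 2), ← coeff_const_mul]
  congr 1
  funext x
  exact transfer_expo hR B α l t x

lemma norm_coeff_nil_sq_le (R : ℤ) (α : ℤ → ℂ) (μ : Measure ℝ) [IsProbabilityMeasure μ]
    {f : ℝ → ℂ} (hf : MemLp f 2 μ) : ‖coeff R α μ [] f‖ ^ 2 ≤ ∫ x, ‖f x‖ ^ 2 ∂μ := by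
  have h0 : ‖coeff R α μ [] f‖ ≤ ∫ x, ‖f x‖ ∂μ := by
    simpa [coeff, freq] using norm_integral_le_integral_norm (μ := μ) f
  refine (pow_le_pow_left₀ (norm_nonneg _) h0 2).trans ?_
  -- Nonnegativity of the variance of `‖f‖` is the required Jensen inequality.
  have hv := ProbabilityTheory.variance_nonneg (fun x => ‖f x‖) μ
  rw [ProbabilityTheory.variance_eq_sub hf.norm] at hv
  simpa using hv


/-! ### Words and the Bessel inequality -/

/-- The empty word. -/
def emptyWord (L : Finset ℤ) : Words L := ⟨[], by simp⟩

/-- Prepend a letter to a reduced word; the letter `0` in front of the empty word is dropped. -/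
def consWord {L : Finset ℤ} (p : L × Words L) : Words L :=
  ⟨if (p.1 : ℤ) = 0 ∧ p.2.1 = [] then [] else (p.1 : ℤ) :: p.2.1, by
    obtain ⟨⟨l, hl⟩, ⟨w, hw⟩⟩ := p
    split_ifs with h
    · simp
    · refine ⟨?_, ?_⟩
      · simpa [hl] using hw.1
      · cases w with
        | nil => simpa using h
        | cons a w => simpa [List.getLast?_cons_cons] using hw.2⟩

/-- The exceptional pair `(0, [])` takes the empty word as its value, and the word `0` that it would
otherwise produce is not reduced; so nothing is lost or hit twice. -/
lemma consWord_bijective {L : Finset ℤ} (hL0 : 0 ∈ L) :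
    Function.Bijective (consWord : L × Words L → Words L) := by
  constructor
  · rintro ⟨⟨l, hl⟩, ⟨w, hw⟩⟩ ⟨⟨l', hl'⟩, ⟨w', hw'⟩⟩ h
    have h := congrArg Subtype.val h
    simp only [consWord] at h
    split_ifs at h with h1 h2 h2
    · obtain ⟨rfl, rfl⟩ := h1
      obtain ⟨rfl, rfl⟩ := h2
      rfl
    · obtain ⟨rfl, rfl⟩ := List.cons.inj h
      rfl
  · rintro ⟨w, hw⟩
    cases w with
    | nil => exact ⟨(⟨0, hL0⟩, ⟨[], hw⟩), Subtype.ext (by simp [consWord])⟩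
    | cons a w =>
      have hw' : (∀ l ∈ w, l ∈ L) ∧ ∀ l ∈ w.getLast?, l ≠ 0 := by
        refine ⟨fun l hl => hw.1 l (List.mem_cons_of_mem _ hl), ?_⟩
        cases w with
        | nil => simp
        | cons b w => simpa [List.getLast?_cons_cons] using hw.2
      refine ⟨(⟨a, hw.1 a List.mem_cons_self⟩, ⟨w, hw'⟩), Subtype.ext ?_⟩
      simp only [consWord]
      rw [if_neg]
      rintro ⟨rfl, rfl⟩
      exact hw.2 0 (by simp) rfl

/-- Reduced words correspond to pairs of a letter and a reduced word. -/
def wordsEquiv {L : Finset ℤ} (hL0 : 0 ∈ L) : L × Words L ≃ Words L :=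
  Equiv.ofBijective consWord (consWord_bijective hL0)

lemma length_le_of_consWord {L : Finset ℤ} {p : L × Words L} {n : ℕ}
    (h : (consWord p).1.length ≤ n + 1) : p.2.1.length ≤ n := by
  simp only [consWord] at h
  split_ifs at h with h0
  · simp [h0.2]
  · simpa using h

/-- The dropped letter is harmless because `α_0 = 1`: the words `0` and `[]` have the same frequency
and the same weight. -/
lemma IsSelfAffineMeasure.coeff_consWord {R : ℤ} (hR : R ≠ 0) {B L : Finset ℤ}
    {μ : Measure ℝ} (h : IsSelfAffineMeasure R B μ) {α : ℤ → ℂ} (hα : α 0 = 1)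
    (p : L × Words L) {f : ℝ → ℂ} (hf : MemLp f 2 μ) :
    coeff R α μ (consWord p).1 f = coeff R α μ p.2.1 (transfer R B α p.1 f) := by
  rw [← h.coeff_cons hR α p.1 p.2.1 hf]
  simp only [consWord]
  split_ifs with h0
  · simp [h0.1, h0.2, coeff, freq, hα]
  · rfl

lemma IsSelfAffineMeasure.sum_norm_coeff_sq_le {R : ℤ} (hR : R ≠ 0) {B L : Finset ℤ}
    (hL0 : 0 ∈ L) {μ : Measure ℝ} (h : IsSelfAffineMeasure R B μ) {α : ℤ → ℂ} (hα : α 0 = 1)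
    (hT : (matT R B L α)ᴴ * matT R B L α = 1) {f : ℝ → ℂ} (hf : MemLp f 2 μ)
    (F : Finset (Words L)) :
    ∑ w ∈ F, ‖coeff R α μ w.1 f‖ ^ 2 ≤ ∫ x, ‖f x‖ ^ 2 ∂μ := by
  classical
  have := h.isProbabilityMeasure
  obtain ⟨n, hn⟩ : ∃ n, ∀ w ∈ F, w.1.length ≤ n :=
    ⟨F.sup fun w => w.1.length, fun w hw => Finset.le_sup (f := fun w : Words L => w.1.length) hw⟩
  -- Induction on the maximal word length. The function must vary, since removing the first letter
  -- replaces `f` by `transfer l f`; enlarging the index set to all letters times the occurring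
  -- tails lets the sum split.
  induction n generalizing f F with
  | zero =>
    have hF : F ⊆ {emptyWord L} := fun w hw =>
      Finset.mem_singleton.2 (Subtype.ext (List.length_eq_zero_iff.1 (Nat.le_zero.1 (hn w hw))))
    refine (Finset.sum_le_sum_of_subset_of_nonneg hF fun _ _ _ => sq_nonneg _).trans ?_
    rw [Finset.sum_singleton]
    exact norm_coeff_nil_sq_le R α μ hf
  | succ n ih =>
    set e := wordsEquiv hL0
    set G : Finset (L × Words L) := F.map e.symm.toEmbedding with hG
    have hGlen : ∀ w ∈ G.image Prod.snd, w.1.length ≤ n := by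
      intro w hw
      obtain ⟨p, hp, rfl⟩ := Finset.mem_image.1 hw
      obtain ⟨v, hv, rfl⟩ := Finset.mem_map.1 hp
      refine length_le_of_consWord (le_of_eq_of_le ?_ (hn v hv))
      exact congrArg (fun u : Words L => u.1.length) (e.apply_symm_apply v)
    calc ∑ w ∈ F, ‖coeff R α μ w.1 f‖ ^ 2
        = ∑ p ∈ G, ‖coeff R α μ p.2.1 (transfer R B α p.1 f)‖ ^ 2 := by
          rw [hG, Finset.sum_map]
          refine Finset.sum_congr rfl fun w _ => ?_
          rw [← h.coeff_consWord hR hα _ hf]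
          exact congrArg (fun u : Words L => ‖coeff R α μ u.1 f‖ ^ 2) (e.apply_symm_apply w).symm
      _ ≤ ∑ p ∈ (Finset.univ : Finset L) ×ˢ G.image Prod.snd,
            ‖coeff R α μ p.2.1 (transfer R B α p.1 f)‖ ^ 2 := by
          refine Finset.sum_le_sum_of_subset_of_nonneg (fun p hp => ?_) fun _ _ _ => sq_nonneg _
          exact Finset.mem_product.2 ⟨Finset.mem_univ _, Finset.mem_image_of_mem _ hp⟩
      _ = ∑ l : L, ∑ w ∈ G.image Prod.snd, ‖coeff R α μ w.1 (transfer R B α l f)‖ ^ 2 :=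
          Finset.sum_product _ _ _
      _ ≤ ∑ l : L, ∫ x, ‖transfer R B α l f x‖ ^ 2 ∂μ :=
          Finset.sum_le_sum fun l _ => ih (h.memLp_transfer α l hf) _ hGlen
      _ = ∫ x, ‖f x‖ ^ 2 ∂μ := by
          rw [Finset.sum_coe_sort L fun l => ∫ x, ‖transfer R B α l f x‖ ^ 2 ∂μ]
          exact h.sum_integral_norm_sq_transfer hR hT hf

lemma IsSelfAffineMeasure.summable_norm_coeff_sq {R : ℤ} (hR : R ≠ 0) {B L : Finset ℤ}
    (hL0 : 0 ∈ L) {μ : Measure ℝ} (h : IsSelfAffineMeasure R B μ) {α : ℤ → ℂ} (hα : α 0 = 1)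
    (hT : (matT R B L α)ᴴ * matT R B L α = 1) {f : ℝ → ℂ} (hf : MemLp f 2 μ) :
    Summable fun w : Words L => ‖coeff R α μ w.1 f‖ ^ 2 :=
  summable_of_sum_le (fun _ => sq_nonneg _) (h.sum_norm_coeff_sq_le hR hL0 hα hT hf)

/-- The function `t ↦ ∑_w |⟨v_w, e_t⟩|²`. -/
def energy (R : ℤ) (L : Finset ℤ) (α : ℤ → ℂ) (μ : Measure ℝ) (t : ℝ) : ℝ :=
  ∑' w : Words L, ‖coeff R α μ w.1 (expo t)‖ ^ 2

lemma IsSelfAffineMeasure.energy_le_one {R : ℤ} (hR : R ≠ 0) {B L : Finset ℤ}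
    (hL0 : 0 ∈ L) {μ : Measure ℝ} (h : IsSelfAffineMeasure R B μ) {α : ℤ → ℂ} (hα : α 0 = 1)
    (hT : (matT R B L α)ᴴ * matT R B L α = 1) (t : ℝ) : energy R L α μ t ≤ 1 := by
  have := h.isProbabilityMeasure
  have hf := memLp_expo μ t 2
  refine (h.summable_norm_coeff_sq hR hL0 hα hT hf).tsum_le_of_sum_le fun F => ?_
  simpa using h.sum_norm_coeff_sq_le hR hL0 hα hT hf F

/-- The empty word alone contributes 1, which already exhausts the Bessel bound. -/
lemma IsSelfAffineMeasure.energy_zero {R : ℤ} (hR : R ≠ 0) {B L : Finset ℤ}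
    (hL0 : 0 ∈ L) {μ : Measure ℝ} (h : IsSelfAffineMeasure R B μ) {α : ℤ → ℂ} (hα : α 0 = 1)
    (hT : (matT R B L α)ᴴ * matT R B L α = 1) : energy R L α μ 0 = 1 := by
  have := h.isProbabilityMeasure
  refine le_antisymm (h.energy_le_one hR hL0 hα hT 0) ?_
  have := (h.summable_norm_coeff_sq hR hL0 hα hT (memLp_expo μ 0 2)).le_tsum
    (emptyWord L) fun _ _ => sq_nonneg _
  simpa [coeff, freq, energy, emptyWord] using this

lemma IsSelfAffineMeasure.energy_eq_sum {R : ℤ} (hR : R ≠ 0) {B L : Finset ℤ}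
    (hL0 : 0 ∈ L) {μ : Measure ℝ} (h : IsSelfAffineMeasure R B μ) {α : ℤ → ℂ} (hα : α 0 = 1)
    (hT : (matT R B L α)ᴴ * matT R B L α = 1) (t : ℝ) :
    ∑ l ∈ L, ‖α l‖ ^ 2 * ‖mB B (g R l t)‖ ^ 2 * energy R L α μ (g R l t) = energy R L α μ t := by
  have := h.isProbabilityMeasure
  have hterm : ∀ p : L × Words L, ‖coeff R α μ (wordsEquiv hL0 p).1 (expo t)‖ ^ 2 =
      ‖α p.1‖ ^ 2 * ‖mB B (g R p.1 t)‖ ^ 2 * ‖coeff R α μ p.2.1 (expo (g R p.1 t))‖ ^ 2 := by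
    intro p
    change ‖coeff R α μ (consWord p).1 (expo t)‖ ^ 2 = _
    rw [h.coeff_consWord hR hα p (memLp_expo μ t 2), ← h.coeff_cons hR α _ _ (memLp_expo μ t 2),
      h.coeff_cons_expo hR]
    simp only [norm_mul, RCLike.norm_conj, mul_pow]
  have hs : Summable fun p : L × Words L => ‖α p.1‖ ^ 2 * ‖mB B (g R p.1 t)‖ ^ 2 *
      ‖coeff R α μ p.2.1 (expo (g R p.1 t))‖ ^ 2 := by
    refine ((wordsEquiv hL0).summable_iff.2
      (h.summable_norm_coeff_sq hR hL0 hα hT (memLp_expo μ t 2))).congr fun p => ?_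
    exact hterm p
  have he : energy R L α μ t = ∑' p : L × Words L, ‖α p.1‖ ^ 2 * ‖mB B (g R p.1 t)‖ ^ 2 *
      ‖coeff R α μ p.2.1 (expo (g R p.1 t))‖ ^ 2 :=
    ((wordsEquiv hL0).tsum_eq _).symm.trans (tsum_congr hterm)
  rw [he, Summable.tsum_prod hs, tsum_fintype, ← Finset.sum_coe_sort L]
  refine Finset.sum_congr rfl fun l _ => ?_
  simp only [tsum_mul_left, energy]

end WeightedFourier

/-! ### Bessel families in Hilbert spaces -/

section Bessel

variable {ι H : Type*} [NormedAddCommGroup H] [InnerProductSpace ℂ H]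

lemma hasSum_norm_sq_lp (f : lp (fun _ : ι => ℂ) 2) : HasSum (fun i => ‖f i‖ ^ 2) (‖f‖ ^ 2) := by
  simpa using lp.hasSum_norm (p := 2) (by norm_num) f

/-- The analysis operator `f ↦ (⟨v_i, f⟩)_i` of a Bessel family. -/
def analysisOp (v : ι → H)
    (hv : ∀ (f : H) (s : Finset ι), ∑ i ∈ s, ‖inner ℂ (v i) f‖ ^ 2 ≤ ‖f‖ ^ 2) :
    H →L[ℂ] lp (fun _ : ι => ℂ) 2 :=
  LinearMap.mkContinuous
    { toFun := fun f => ⟨fun i => inner ℂ (v i) f, memℓp_gen' (C := ‖f‖ ^ 2) fun s => by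
        simpa using hv f s⟩
      map_add' := fun f g => by ext i; exact inner_add_right _ _ _
      map_smul' := fun c f => by ext i; exact inner_smul_right _ _ _ } 1 fun f => by
    rw [one_mul]
    refine lp.norm_le_of_forall_sum_le (by norm_num) (norm_nonneg _) fun s => ?_
    simpa using hv f s

lemma hasSum_analysisOp (v : ι → H)
    (hv : ∀ (f : H) (s : Finset ι), ∑ i ∈ s, ‖inner ℂ (v i) f‖ ^ 2 ≤ ‖f‖ ^ 2) (f : H) :
    HasSum (fun i => ‖inner ℂ (v i) f‖ ^ 2) (‖analysisOp v hv f‖ ^ 2) :=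
  hasSum_norm_sq_lp (analysisOp v hv f)

lemma norm_analysisOp_le (v : ι → H)
    (hv : ∀ (f : H) (s : Finset ι), ∑ i ∈ s, ‖inner ℂ (v i) f‖ ^ 2 ≤ ‖f‖ ^ 2) :
    ‖analysisOp v hv‖ ≤ 1 :=
  LinearMap.mkContinuous_norm_le _ zero_le_one _

/-- A Bessel family with bound `1` that satisfies the Parseval identity on a total set is a
Parseval frame. -/
lemma isParsevalFrame_of_total [CompleteSpace H] (v : ι → H)
    (hv : ∀ (f : H) (s : Finset ι), ∑ i ∈ s, ‖inner ℂ (v i) f‖ ^ 2 ≤ ‖f‖ ^ 2) (D : Set H)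
    (hD : ∀ f : H, (∀ d ∈ D, inner ℂ d f = 0) → f = 0)
    (h : ∀ d ∈ D, ∑' i, ‖inner ℂ (v i) d‖ ^ 2 = ‖d‖ ^ 2) : WeightedFourier.IsParsevalFrame v := by
  set A := analysisOp v hv with hA
  -- The Parseval defect is quadratic, so it does not pass directly from `D` to its span. For a
  -- contraction `A`, however, its vanishing at `d` forces the linear condition `S d = 0`; since `S`
  -- is self-adjoint, its range is then orthogonal to `D`.
  set S : H →L[ℂ] H := 1 - A.adjoint ∘L A with hS
  have hAd : ‖A.adjoint‖ ≤ 1 := by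
    rw [LinearIsometryEquiv.norm_map]
    exact norm_analysisOp_le v hv
  have hSd : ∀ d ∈ D, S d = 0 := by
    intro d hd
    have h1 : ‖A d‖ ^ 2 = ‖d‖ ^ 2 := by
      rw [← h d hd]
      exact (hasSum_analysisOp v hv d).tsum_eq.symm
    have h2 : ‖A.adjoint (A d)‖ ^ 2 ≤ ‖d‖ ^ 2 := by
      rw [← h1]
      refine pow_le_pow_left₀ (norm_nonneg _) ?_ 2
      exact (A.adjoint.le_opNorm _).trans (mul_le_of_le_one_left (norm_nonneg _) hAd)
    have h3 : ‖S d‖ ^ 2 = ‖d‖ ^ 2 - 2 * ‖A d‖ ^ 2 + ‖A.adjoint (A d)‖ ^ 2 := by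
      have : S d = d - A.adjoint (A d) := rfl
      rw [this, norm_sub_sq (𝕜 := ℂ), ContinuousLinearMap.adjoint_inner_right,
        inner_self_eq_norm_sq]
    have h4 : ‖S d‖ ^ 2 ≤ 0 := by linarith
    exact norm_eq_zero.1 (pow_eq_zero_iff two_ne_zero |>.1 (le_antisymm h4 (sq_nonneg _)))
  have hsa : ∀ x y : H, inner ℂ (S x) y = inner ℂ x (S y) := by
    intro x y
    have e : ∀ z, S z = z - A.adjoint (A z) := fun z => rfl
    rw [e, e, inner_sub_left, inner_sub_right, ContinuousLinearMap.adjoint_inner_left,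
      ContinuousLinearMap.adjoint_inner_right]
  have hS0 : ∀ f, S f = 0 := fun f => hD _ fun d hd => by rw [← hsa, hSd d hd, inner_zero_left]
  intro f
  have hf : A.adjoint (A f) = f := (sub_eq_zero.1 (hS0 f)).symm
  have : ‖A f‖ ^ 2 = ‖f‖ ^ 2 := by
    rw [← inner_self_eq_norm_sq (𝕜 := ℂ) (A f), ← ContinuousLinearMap.adjoint_inner_right, hf,
      inner_self_eq_norm_sq]
  rw [← this]
  exact hasSum_analysisOp v hv f

end Bessel

end

noncomputable section

namespace WeightedFourier

/-! ### Analytic harmonic functions -/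

/-- Every nonempty finite invariant set contains a finite minimal invariant set. -/
lemma exists_isFiniteMinimalInvariant {R : ℤ} {B L : Finset ℤ} {α : ℤ → ℂ} {Z : Set ℝ}
    (hfin : Z.Finite) (hne : Z.Nonempty) (hZ : IsInvariant R B L α Z) :
    ∃ M ⊆ Z, IsFiniteMinimalInvariant R B L α M := by
  have hsub : {S : Set ℝ | S ⊆ Z ∧ S.Nonempty ∧ IsInvariant R B L α S}.Finite :=
    hfin.finite_subsets.subset fun S hS => hS.1
  obtain ⟨M, hMZ, hM⟩ := hsub.exists_le_minimal (a := Z) ⟨subset_rfl, hne, hZ⟩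
  refine ⟨M, hMZ, hfin.subset hMZ, hM.prop.2, fun S hS hSM => ?_⟩
  exact hM.le_of_le ⟨hSM.trans hMZ, hS⟩ hSM

lemma exists_g_invariant_Icc {R : ℤ} (hR : 2 ≤ |R|) (L : Finset ℤ) :
    ∃ K : ℝ, 0 < K ∧ ∀ l ∈ L, ∀ t ∈ Set.Icc (-K) K, g R l t ∈ Set.Icc (-K) K := by
  have h2 : (2 : ℝ) ≤ |(R : ℝ)| := by exact_mod_cast hR
  have hnn : 0 ≤ ∑ l ∈ L, |(l : ℝ)| := Finset.sum_nonneg fun _ _ => abs_nonneg _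
  -- `|t - l| / |R| ≤ (K + |l|) / 2 ≤ K` as soon as `K ≥ |l|`; the extra 1 makes 0 an interior
  -- point.
  refine ⟨∑ l ∈ L, |(l : ℝ)| + 1, by linarith, fun l hl t ht => ?_⟩
  have h1 : |(l : ℝ)| ≤ ∑ l ∈ L, |(l : ℝ)| :=
    Finset.single_le_sum (f := fun l : ℤ => |(l : ℝ)|) (fun _ _ => abs_nonneg _) hl
  have ht' := abs_le.2 ht
  refine abs_le.1 ?_
  unfold g
  rw [abs_div, div_le_iff₀ (by linarith)]
  have := abs_sub t (l : ℝ)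
  nlinarith

/-- If `{0}` is the only finite minimal invariant set, then a real analytic harmonic function `h`
with `h ≤ 1 = h(0)` is constant. -/
lemma eq_one_of_analytic {R : ℤ} (hR : 2 ≤ |R|) {B L : Finset ℤ} (hB : B.Nonempty) {α : ℤ → ℂ}
    (hT : (matT R B L α)ᴴ * matT R B L α = 1)
    (hmin : ∀ M : Set ℝ, IsFiniteMinimalInvariant R B L α M → M = {0})
    {h : ℝ → ℝ} (han : AnalyticOnNhd ℝ h Set.univ) (hle : ∀ t, h t ≤ 1) (h0 : h 0 = 1)
    (hfix : ∀ t, ∑ l ∈ L, ‖α l‖ ^ 2 * ‖mB B (g R l t)‖ ^ 2 * h (g R l t) = h t) :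
    h = fun _ => 1 := by
  have hR0 : R ≠ 0 := by rintro rfl; simp at hR
  obtain ⟨K, hK, hg⟩ := exists_g_invariant_Icc hR L
  have h0mem : (0 : ℝ) ∈ Set.Icc (-K) K := ⟨by linarith, hK.le⟩
  obtain ⟨t₀, ht₀, hm⟩ := isCompact_Icc.exists_isMinOn ⟨0, h0mem⟩
    (han.continuousOn.mono (Set.subset_univ (Set.Icc (-K) K)))
  have hmle : ∀ t ∈ Set.Icc (-K) K, h t₀ ≤ h t := fun t ht => hm ht
  set Z : Set ℝ := {t | t ∈ Set.Icc (-K) K ∧ h t = h t₀} with hZ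
  have hZinv : IsInvariant R B L α Z := by
    rintro t ⟨htI, ht⟩ l hl hne
    refine ⟨hg l hl t htI, ?_⟩
    -- The value at a minimizer is an average of values at its successors, so each successor of
    -- positive probability is again a minimizer.
    have hsum : ∑ l ∈ L, ‖α l‖ ^ 2 * ‖mB B (g R l t)‖ ^ 2 * (h (g R l t) - h t₀) = 0 := by
      simp only [mul_sub, Finset.sum_sub_distrib, ← Finset.sum_mul]
      rw [hfix, sum_transition hR0 hB hT, ht, one_mul, sub_self]
    have hz := (Finset.sum_eq_zero_iff_of_nonneg fun l hl => mul_nonneg (by positivity)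
      (sub_nonneg.2 (hmle _ (hg l hl t htI)))).1 hsum l hl
    rcases mul_eq_zero.1 hz with hz | hz
    · exfalso
      rw [← mul_pow, ← norm_mul] at hz
      exact hne (norm_eq_zero.1 (pow_eq_zero_iff two_ne_zero |>.1 hz))
    · exact sub_eq_zero.1 hz
  have hconst : AnalyticOnNhd ℝ (fun _ : ℝ => h t₀) Set.univ := analyticOnNhd_const
  by_cases hfin : Z.Finite
  · obtain ⟨M, hMZ, hM⟩ := exists_isFiniteMinimalInvariant hfin ⟨t₀, ht₀, rfl⟩ hZinv
    have h0Z : (0 : ℝ) ∈ Z := hMZ (by rw [hmin M hM]; rfl)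
    have hmin1 : h t₀ = 1 := by rw [← h0Z.2, h0]
    -- On a neighbourhood of 0 inside the interval, `h` lies between its minimum 1 and its upper
    -- bound 1.
    refine han.eq_of_eventuallyEq analyticOnNhd_const (z₀ := 0) ?_
    filter_upwards [Icc_mem_nhds (show -K < 0 by linarith) hK] with t ht
    exact le_antisymm (hle t) (hmin1 ▸ hmle t ht)
  · obtain ⟨z, -, hz⟩ := Set.Infinite.exists_accPt_of_subset_isCompact hfin isCompact_Icc
      fun t ht => ht.1
    have : h = fun _ => h t₀ := by
      refine han.eq_of_frequently_eq hconst (z₀ := z) ?_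
      exact (accPt_iff_frequently_nhdsNE.1 hz).mono fun t ht => ht.2
    rw [this] at h0
    rw [this]
    funext t
    exact h0

/-- The minimum principle applies to the restriction to the real line, and the identity theorem
carries the value 1 from there to the plane. -/
lemma onlyConstantHarmonic_of_minimal {R : ℤ} (hR : 2 ≤ |R|) {B L : Finset ℤ} (hB : B.Nonempty)
    {α : ℤ → ℂ} (hT : (matT R B L α)ᴴ * matT R B L α = 1)
    (hmin : ∀ M : Set ℝ, IsFiniteMinimalInvariant R B L α M → M = {0}) :
    OnlyConstantHarmonic R B L α := by
  have hR0 : R ≠ 0 := by rintro rfl; simp at hR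
  intro h
  constructor
  · intro hh
    have hre : ∀ t : ℝ, h t = ((h t).re : ℂ) := fun t =>
      Complex.ext rfl (by simpa using hh.real_on_reals t)
    have han : AnalyticOnNhd ℂ h Set.univ :=
      fun z _ => hh.entire.analyticAt z
    have han' : AnalyticOnNhd ℝ (fun t : ℝ => (h t).re) Set.univ := by
      intro t _
      have h1 : AnalyticAt ℝ h (t : ℂ) := (han t trivial).restrictScalars
      exact (Complex.reCLM.analyticAt _).comp (h1.comp (Complex.ofRealCLM.analyticAt t))
    have key := eq_one_of_analytic hR hB hT hmin han' (fun t => (hh.bounds t).2)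
      (by simp [hh.at_zero]) fun t => by
        have := congrArg Complex.re (hh.fixed t)
        rw [Complex.re_sum] at this
        simpa only [Complex.re_ofReal_mul] using this
    refine han.eq_of_frequently_eq analyticOnNhd_const (z₀ := 0) ?_
    have hfreq : ∃ᶠ t : ℝ in nhdsWithin 0 {0}ᶜ, h t = 1 :=
      (Filter.Eventually.of_forall fun t => by rw [hre t, congrFun key t, Complex.ofReal_one]).frequently
    have hmap : Filter.Tendsto (fun t : ℝ => (t : ℂ)) (nhdsWithin 0 {0}ᶜ) (nhdsWithin 0 {0}ᶜ) := by
      refine tendsto_nhdsWithin_of_tendsto_nhds_of_eventually_within _ ?_ ?_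
      · exact (Complex.continuous_ofReal.tendsto' 0 0 rfl).mono_left nhdsWithin_le_nhds
      · filter_upwards [self_mem_nhdsWithin] with t ht
        simpa using ht
    exact hmap.frequently hfreq
  · rintro rfl
    refine ⟨differentiable_const _, fun _ => by simp, fun _ => by simp, rfl, fun t => ?_⟩
    simp only [mul_one]
    rw [← Complex.ofReal_sum, sum_transition hR0 hB hT, Complex.ofReal_one]


/-! ### Analyticity of `t ↦ e_t` -/

/-- If `|τ_b(x)| > r` then `|x| > 2r - C`, so invariance bounds the tail at `r` by the tail at `2r -
C`. The map `r ↦ 2r - C` fixes `C` and doubles the distance from it, so the tail at `C + 1` is at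
most the tail at `C + 2^n` for every `n`. -/
lemma IsSelfAffineMeasure.exists_support_bound {R : ℤ} (hR : 2 ≤ |R|) {B : Finset ℤ}
    {μ : Measure ℝ} (h : IsSelfAffineMeasure R B μ) : ∃ K : ℝ, ∀ᵐ x ∂μ, |x| ≤ K := by
  have := h.isProbabilityMeasure
  have h2 : (2 : ℝ) ≤ |(R : ℝ)| := by exact_mod_cast hR
  set C : ℝ := ∑ b ∈ B, |(b : ℝ)| with hC
  have hmeas : ∀ r : ℝ, MeasurableSet {x : ℝ | r < |x|} := fun r =>
    measurableSet_lt measurable_const (by fun_prop)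
  have hstep : ∀ r : ℝ, 0 ≤ r → μ {x | r < |x|} ≤ μ {x | 2 * r - C < |x|} := by
    intro r hr
    have hb : ∀ b ∈ B, μ (tau R b ⁻¹' {x | r < |x|}) ≤ μ {x | 2 * r - C < |x|} := by
      intro b hb
      refine measure_mono fun x hx => ?_
      have h1 : |(b : ℝ)| ≤ C :=
        Finset.single_le_sum (f := fun b : ℤ => |(b : ℝ)|) (fun _ _ => abs_nonneg _) hb
      have hx' : r < |(x + b) / (R : ℝ)| := hx
      rw [abs_div, lt_div_iff₀ (by linarith)] at hx'
      have h3 := abs_add_le x (b : ℝ)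
      change 2 * r - C < |x|
      nlinarith
    rw [h.invariance _ (hmeas r)]
    refine (mul_le_mul_right (Finset.sum_le_sum hb) _).trans ?_
    rw [Finset.sum_const, nsmul_eq_mul, ← mul_assoc]
    exact mul_le_of_le_one_left zero_le (ENNReal.inv_mul_le_one _)
  have hC0 : 0 ≤ C := Finset.sum_nonneg fun _ _ => abs_nonneg _
  have hit : ∀ n : ℕ, μ {x | C + 1 < |x|} ≤ μ {x | C + 2 ^ n < |x|} := by
    intro n
    induction n with
    | zero => simp
    | succ n ih =>
      refine ih.trans ((hstep _ (by positivity)).trans_eq ?_)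
      congr 2
      ext x
      rw [pow_succ]
      ring_nf
  have hanti : Antitone fun n : ℕ => {x : ℝ | C + 2 ^ n < |x|} := by
    intro m n hmn x hx
    have : (2 : ℝ) ^ m ≤ 2 ^ n := pow_le_pow_right₀ one_le_two hmn
    simp only [Set.mem_ofPred_eq] at hx ⊢
    linarith
  have hlim := tendsto_measure_iInter_atTop (μ := μ) (fun n => (hmeas (C + 2 ^ n)).nullMeasurableSet)
    hanti ⟨0, measure_ne_top _ _⟩
  have hempty : ⋂ n : ℕ, {x : ℝ | C + 2 ^ n < |x|} = ∅ := by
    refine Set.eq_empty_of_forall_notMem fun x hx => ?_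
    obtain ⟨n, hn⟩ := pow_unbounded_of_one_lt |x| one_lt_two
    have := Set.mem_iInter.1 hx n
    simp only [Set.mem_ofPred_eq] at this
    linarith
  rw [hempty, measure_empty] at hlim
  refine ⟨C + 1, ?_⟩
  rw [ae_iff]
  simp only [not_le]
  exact le_antisymm (ge_of_tendsto' hlim hit) zero_le

/-- `e_t` is the exponential of `t φ` in the Banach algebra of bounded continuous functions, where
`exp` is analytic, followed by a continuous linear map to `L²(μ)`. The order `⊤` means analytic, not
merely smooth. -/
lemma contDiff_expL2 {μ : Measure ℝ} [IsFiniteMeasure μ] {K : ℝ} (hK : ∀ᵐ x ∂μ, |x| ≤ K) :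
    ContDiff ℝ ⊤ (expL2 μ) := by
  -- `2πix` is unbounded, so `x` is truncated to `[-|K|, |K|]`, which changes nothing almost
  -- everywhere; the absolute value is there because `K` may be negative when `μ = 0`.
  let φ : BoundedContinuousFunction ℝ ℂ := BoundedContinuousFunction.ofNormedAddCommGroup
    (fun x : ℝ => 2 * Real.pi * Complex.I * ((max (-|K|) (min x |K|) : ℝ) : ℂ)) (by fun_prop)
    (2 * Real.pi * |K|) fun x => by
      have : |max (-|K|) (min x |K|)| ≤ |K| :=
        abs_le.2 ⟨le_max_left _ _, max_le (by linarith [abs_nonneg K]) (min_le_right _ _)⟩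
      simp only [norm_mul, Complex.norm_real, Complex.norm_I, Real.norm_eq_abs, mul_one,
        abs_of_pos Real.pi_pos, Complex.norm_ofNat]
      gcongr
  have heq : expL2 μ = fun t : ℝ => BoundedContinuousFunction.toLp 2 μ ℝ
      (NormedSpace.exp (t • φ)) := by
    funext t
    refine Lp.ext ?_
    filter_upwards [coeFn_expL2 μ t, BoundedContinuousFunction.coeFn_toLp (p := 2) (𝕜 := ℝ) μ
      (NormedSpace.exp (t • φ)), hK] with x h1 h2 hx
    rw [h1, h2]
    let ev : BoundedContinuousFunction ℝ ℂ →+* ℂ :=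
      { toFun := fun f => f x
        map_one' := rfl
        map_mul' := fun _ _ => rfl
        map_zero' := rfl
        map_add' := fun _ _ => rfl }
    have hev : Continuous ev := (BoundedContinuousFunction.evalCLM ℂ x).continuous
    have hexp : (NormedSpace.exp (t • φ)) x = NormedSpace.exp ((t • φ) x) :=
      NormedSpace.map_exp ev hev (t • φ)
    rw [hexp, ← Complex.exp_eq_exp_ℂ]
    unfold expo
    congr 1
    have hxK := abs_le.1 (hx.trans (le_abs_self K))
    have : (t • φ) x = (t : ℂ) * (2 * Real.pi * Complex.I * ((max (-|K|) (min x |K|) : ℝ) : ℂ)) :=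
      Complex.real_smul
    rw [this, min_eq_left hxK.2, max_eq_right hxK.1]
    ring
  rw [heq]
  let T : BoundedContinuousFunction ℝ ℂ →L[ℝ] Lp ℂ 2 μ := BoundedContinuousFunction.toLp 2 μ ℝ
  refine T.contDiff.comp ?_
  have hexp : ContDiff ℝ ⊤ (NormedSpace.exp : BoundedContinuousFunction ℝ ℂ → _) :=
    contDiff_omega_iff_analyticOnNhd.2 fun x _ => NormedSpace.exp_analytic x
  exact hexp.comp (contDiff_id.smul contDiff_const)

/-! ### Totality of the exponentials -/

/-- The positive and negative parts of `f` are densities of two finite measures with equal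
characteristic functions. The measures coincide, so the two parts agree almost everywhere, which
forces `f = 0`. -/
lemma ae_eq_zero_of_integral_expo_ofReal {μ : Measure ℝ} [IsFiniteMeasure μ] {f : ℝ → ℝ}
    (hf : Integrable f μ) (h : ∀ t : ℝ, ∫ x, expo t x * f x ∂μ = 0) : f =ᵐ[μ] 0 := by
  have hp : ∀ {k : ℝ → ℝ}, Integrable k μ →
      IsFiniteMeasure (μ.withDensity fun x => ENNReal.ofReal (k x)) := fun hk =>
    isFiniteMeasure_withDensity_ofReal hk.2
  have hchar : ∀ {k : ℝ → ℝ}, Integrable k μ → ∀ t : ℝ,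
      charFun (μ.withDensity fun x => ENNReal.ofReal (k x)) t =
        ∫ x, expo (t / (2 * Real.pi)) x * (max (k x) 0 : ℝ) ∂μ := by
    intro k hk t
    rw [charFun_apply_real, integral_withDensity_eq_integral_toReal_smul₀
      hk.aestronglyMeasurable.aemeasurable.ennreal_ofReal (by simp)]
    refine integral_congr_ae (Filter.Eventually.of_forall fun x => ?_)
    simp only [ENNReal.toReal_ofReal', Complex.real_smul]
    rw [mul_comm]
    congr 1
    unfold expo
    congr 1
    have : (Real.pi : ℂ) ≠ 0 := by exact_mod_cast Real.pi_ne_zero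
    push_cast
    field_simp
  have hint : ∀ {k : ℝ → ℝ}, Integrable k μ → ∀ t : ℝ,
      Integrable (fun x => expo t x * (max (k x) 0 : ℝ)) μ := fun hk t =>
    (hk.pos_part.ofReal (𝕜 := ℂ)).bdd_mul (c := 1) (continuous_expo t).aestronglyMeasurable
      (Filter.Eventually.of_forall fun x => by simp)
  have hfn : Integrable (fun x => -f x) μ := hf.neg
  have := hp hf
  have := hp hfn
  have heq : (μ.withDensity fun x => ENNReal.ofReal (f x)) =
      μ.withDensity fun x => ENNReal.ofReal (-f x) := by
    refine Measure.ext_of_charFun (funext fun t => ?_)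
    rw [hchar hf, hchar hfn, ← sub_eq_zero, ← integral_sub (hint hf _) (hint hfn _),
      ← h (t / (2 * Real.pi))]
    refine integral_congr_ae (Filter.Eventually.of_forall fun x => ?_)
    simp only
    rw [← mul_sub, ← Complex.ofReal_sub]
    congr 2
    rcases le_total (f x) 0 with hx | hx
    · rw [max_eq_right hx, max_eq_left (by linarith)]; ring
    · rw [max_eq_left hx, max_eq_right (by linarith)]; ring
  have hae := (withDensity_eq_iff hf.aestronglyMeasurable.aemeasurable.ennreal_ofReal
    hfn.aestronglyMeasurable.aemeasurable.ennreal_ofReal hf.lintegral_lt_top.ne).1 heq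
  filter_upwards [hae] with x hx
  have h1 := congrArg ENNReal.toReal hx
  simp only [ENNReal.toReal_ofReal'] at h1
  rcases le_total (f x) 0 with hx | hx
  · rw [max_eq_right hx, max_eq_left (by linarith)] at h1
    change f x = 0
    linarith
  · rw [max_eq_left hx, max_eq_right (by linarith)] at h1
    exact h1

lemma inner_expL2 (μ : Measure ℝ) [IsFiniteMeasure μ] (t : ℝ) (f : Lp ℂ 2 μ) :
    inner ℂ (expL2 μ t) f = ∫ x, expo (-t) x * f x ∂μ := by
  rw [L2.inner_def]
  refine integral_congr_ae ?_
  filter_upwards [coeFn_expL2 μ t] with x hx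
  rw [hx, RCLike.inner_apply, star_expo, mul_comm]

/-- All real frequencies are available, so conjugation shows that `conj f` has vanishing transform
as well; the real case then handles real and imaginary parts. -/
lemma eq_zero_of_inner_expL2_eq_zero {μ : Measure ℝ} [IsFiniteMeasure μ] {f : Lp ℂ 2 μ}
    (h : ∀ t, inner ℂ (expL2 μ t) f = 0) : f = 0 := by
  have hf : Integrable f μ := (Lp.memLp f).integrable one_le_two
  have h1 : ∀ t, ∫ x, expo t x * f x ∂μ = 0 := fun t => by
    have := h (-t)
    rwa [inner_expL2, neg_neg] at this
  have h2 : ∀ t, ∫ x, expo t x * (starRingEnd ℂ) (f x) ∂μ = 0 := fun t => by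
    have := congrArg (starRingEnd ℂ) (h1 (-t))
    rw [← integral_conj, map_zero] at this
    simpa only [map_mul, star_expo, neg_neg] using this
  have hbdd : ∀ (t : ℝ) {k : ℝ → ℂ}, Integrable k μ → Integrable (fun x => expo t x * k x) μ :=
    fun t k hk => hk.bdd_mul (c := 1) (continuous_expo t).aestronglyMeasurable
      (Filter.Eventually.of_forall fun x => by simp)
  have hfc : Integrable (fun x => (starRingEnd ℂ) (f x)) μ :=
    Complex.conjCLE.toContinuousLinearMap.integrable_comp hf
  have hre := ae_eq_zero_of_integral_expo_ofReal hf.re fun t => by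
    have e : ∀ x, expo t x * ((f x).re : ℂ) =
        (1 / 2) * (expo t x * f x + expo t x * (starRingEnd ℂ) (f x)) := fun x => by
      rw [Complex.re_eq_add_conj]; ring
    change ∫ x, expo t x * ((f x).re : ℂ) ∂μ = 0
    simp only [e]
    rw [integral_const_mul, integral_add (hbdd t hf) (hbdd t hfc), h1, h2, add_zero, mul_zero]
  have him := ae_eq_zero_of_integral_expo_ofReal hf.im fun t => by
    have e : ∀ x, expo t x * ((f x).im : ℂ) =
        (1 / (2 * Complex.I)) * (expo t x * f x - expo t x * (starRingEnd ℂ) (f x)) := fun x => by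
      rw [Complex.im_eq_sub_conj]; ring
    change ∫ x, expo t x * ((f x).im : ℂ) ∂μ = 0
    simp only [e]
    rw [integral_const_mul, integral_sub (hbdd t hf) (hbdd t hfc), h1, h2, sub_zero, mul_zero]
  refine (Lp.eq_zero_iff_ae_eq_zero).2 ?_
  filter_upwards [hre, him] with x hx hy
  exact Complex.ext hx hy


/-! ### The family of weighted exponentials -/

lemma inner_weightedExp (R : ℤ) (B L : Finset ℤ) (α : ℤ → ℂ) (w : Words L)
    (f : Lp ℂ 2 (selfAffineMeasure R B)) :
    inner ℂ (weightedExp R B L α w) f = coeff R α (selfAffineMeasure R B) w.1 f := by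
  rw [weightedExp, inner_smul_left, inner_expL2, coeff]

lemma inner_weightedExp_expL2 (R : ℤ) (B L : Finset ℤ) (α : ℤ → ℂ) (w : Words L) (t : ℝ) :
    inner ℂ (weightedExp R B L α w) (expL2 (selfAffineMeasure R B) t) =
      coeff R α (selfAffineMeasure R B) w.1 (expo t) := by
  rw [inner_weightedExp, coeff, coeff]
  congr 1
  refine integral_congr_ae ?_
  filter_upwards [coeFn_expL2 (selfAffineMeasure R B) t] with x hx
  rw [hx]

lemma norm_sq_Lp_two (μ : Measure ℝ) (f : Lp ℂ 2 μ) : ‖f‖ ^ 2 = ∫ x, ‖f x‖ ^ 2 ∂μ := by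
  have h : ((‖f‖ ^ 2 : ℝ) : ℂ) = ((∫ x, ‖f x‖ ^ 2 ∂μ : ℝ) : ℂ) := by
    rw [← integral_complex_ofReal]
    have := (inner_self_eq_norm_sq_to_K (𝕜 := ℂ) f).symm
    rw [L2.inner_def] at this
    simpa [inner_self_eq_norm_sq_to_K] using this
  exact_mod_cast h

lemma norm_expL2 (μ : Measure ℝ) [IsProbabilityMeasure μ] (t : ℝ) : ‖expL2 μ t‖ ^ 2 = 1 := by
  rw [norm_sq_Lp_two]
  have : ∫ x, ‖expL2 μ t x‖ ^ 2 ∂μ = ∫ _, (1 : ℝ) ∂μ := by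
    refine integral_congr_ae ?_
    filter_upwards [coeFn_expL2 μ t] with x hx
    rw [hx, norm_expo, one_pow]
  rw [this]
  simp

lemma bessel_weightedExp {R : ℤ} (hR : 2 ≤ |R|) {B : Finset ℤ} (hB : B.Nonempty) {L : Finset ℤ}
    (hL0 : 0 ∈ L) {α : ℤ → ℂ} (hα : α 0 = 1) (hT : (matT R B L α)ᴴ * matT R B L α = 1)
    (f : Lp ℂ 2 (selfAffineMeasure R B)) (s : Finset (Words L)) :
    ∑ w ∈ s, ‖inner ℂ (weightedExp R B L α w) f‖ ^ 2 ≤ ‖f‖ ^ 2 := by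
  have hR0 : R ≠ 0 := by rintro rfl; simp at hR
  simp only [inner_weightedExp, norm_sq_Lp_two]
  exact (isSelfAffineMeasure_selfAffineMeasure hR hB).sum_norm_coeff_sq_le hR0 hL0 hα hT
    (Lp.memLp f) s

lemma isParsevalFrame_weightedExp {R : ℤ} (hR : 2 ≤ |R|) {B : Finset ℤ} (hB : B.Nonempty)
    {L : Finset ℤ} (hL0 : 0 ∈ L) {α : ℤ → ℂ} (hα : α 0 = 1)
    (hT : (matT R B L α)ᴴ * matT R B L α = 1)
    (hmin : ∀ M : Set ℝ, IsFiniteMinimalInvariant R B L α M → M = {0}) :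
    IsParsevalFrame (weightedExp R B L α) := by
  have hR0 : R ≠ 0 := by rintro rfl; simp at hR
  have hμ := isSelfAffineMeasure_selfAffineMeasure hR hB
  have := hμ.isProbabilityMeasure
  have hbes := bessel_weightedExp hR hB hL0 hα hT
  -- Writing the energy as the squared norm of a bounded linear image of `e_t` gives its analyticity
  -- without differentiating the series.
  have henergy : ∀ t, energy R L α (selfAffineMeasure R B) t =
      ‖analysisOp (weightedExp R B L α) hbes (expL2 (selfAffineMeasure R B) t)‖ ^ 2 := by
    intro t
    rw [← (hasSum_analysisOp _ hbes _).tsum_eq]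
    simp only [inner_weightedExp_expL2, energy]
  have han : AnalyticOnNhd ℝ (energy R L α (selfAffineMeasure R B)) Set.univ := by
    obtain ⟨K, hK⟩ := hμ.exists_support_bound hR
    rw [← contDiff_omega_iff_analyticOnNhd, funext henergy]
    have hA := ((analysisOp (weightedExp R B L α) hbes).restrictScalars ℝ).contDiff (n := ⊤)
    exact (hA.comp (contDiff_expL2 hK)).norm_sq ℂ
  have hone := eq_one_of_analytic hR hB hT hmin han (hμ.energy_le_one hR0 hL0 hα hT)
    (hμ.energy_zero hR0 hL0 hα hT) (hμ.energy_eq_sum hR0 hL0 hα hT)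
  refine isParsevalFrame_of_total _ hbes (Set.range (expL2 (selfAffineMeasure R B)))
    (fun f hf => eq_zero_of_inner_expL2_eq_zero fun t => hf _ ⟨t, rfl⟩) ?_
  rintro _ ⟨t, rfl⟩
  rw [norm_expL2, ← congrFun hone t]
  simp only [inner_weightedExp_expL2, energy]

/-! ### Nontrivial finite invariant sets -/

lemma g_zero (R : ℤ) (t : ℝ) : g R 0 t = t / R := by simp [g]

/-- From 0 the digit 0 leads back to 0 with probability `|α_0 m_B(0)|² = 1`, so all other
transitions have probability 0. -/
lemma isInvariant_singleton_zero {R : ℤ} (hR : R ≠ 0) {B L : Finset ℤ} (hB : B.Nonempty)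
    (hL0 : 0 ∈ L) {α : ℤ → ℂ} (hα : α 0 = 1) (hT : (matT R B L α)ᴴ * matT R B L α = 1) :
    IsInvariant R B L α {0} := by
  rintro t rfl l hl hne
  by_contra hl0
  have hl0' : l ≠ 0 := by
    rintro rfl
    exact hl0 (by simp [g])
  have hsum := sum_transition hR hB hT 0
  have hm : mB B (g R 0 0) = 1 := by
    have : (B.card : ℂ) ≠ 0 := by exact_mod_cast hB.card_pos.ne'
    simp [mB_eq, g, this]
  rw [← Finset.add_sum_erase _ _ hL0, hα, hm] at hsum
  have hz : ∑ k ∈ L.erase 0, ‖α k‖ ^ 2 * ‖mB B (g R k 0)‖ ^ 2 = 0 := by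
    simpa using hsum
  have := (Finset.sum_eq_zero_iff_of_nonneg fun _ _ => by positivity).1 hz l
    (Finset.mem_erase.2 ⟨hl0', hl⟩)
  rw [← mul_pow, ← norm_mul] at this
  exact hne (norm_eq_zero.1 (pow_eq_zero_iff two_ne_zero |>.1 this))

lemma zero_notMem_of_minimal {R : ℤ} (hR : R ≠ 0) {B L : Finset ℤ} (hB : B.Nonempty)
    (hL0 : 0 ∈ L) {α : ℤ → ℂ} (hα : α 0 = 1) (hT : (matT R B L α)ᴴ * matT R B L α = 1)
    {M : Set ℝ} (hM : IsFiniteMinimalInvariant R B L α M) (hM0 : M ≠ {0}) : (0 : ℝ) ∉ M := by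
  intro h0
  have hsub : ({0} : Set ℝ) ⊆ M := Set.singleton_subset_iff.2 h0
  exact hM0 (hM.2.eq_of_subset
    ⟨Set.singleton_nonempty 0, isInvariant_singleton_zero hR hB hL0 hα hT⟩ hsub).symm

/-- This coefficient is the Fourier transform of `μ`, with the factor `m_B(t / R)` in passing from
`t / R` to `t`. If it is nonzero at `c`, no factor `m_B(c / R^n)` with `n ≥ 1` vanishes, so, as `α_0
= 1`, the digit 0 keeps the infinitely many distinct points `c / R^n` in `M`. -/
lemma coeff_nil_expo_eq_zero {R : ℤ} (hR : 2 ≤ |R|) {B L : Finset ℤ} (hL0 : 0 ∈ L)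
    {μ : Measure ℝ} (hμ : IsSelfAffineMeasure R B μ) {α : ℤ → ℂ} (hα : α 0 = 1) {M : Set ℝ}
    (hfin : M.Finite) (hM : IsInvariant R B L α M) {c : ℝ} (hc : c ∈ M) (hc0 : c ≠ 0) :
    coeff R α μ [] (expo c) = 0 := by
  have hR0 : R ≠ 0 := by rintro rfl; simp at hR
  by_contra hne
  have hstep : ∀ t, coeff R α μ [] (expo t) = mB B (t / R) * coeff R α μ [] (expo (t / R)) := by
    intro t
    have h1 := hμ.coeff_cons_expo hR0 α 0 [] t
    rw [g_zero, hα, map_one, one_mul] at h1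
    rw [← h1]
    simp [coeff, freq, hα]
  have hall : ∀ n : ℕ, c / (R : ℝ) ^ n ∈ M ∧ coeff R α μ [] (expo (c / (R : ℝ) ^ n)) ≠ 0 := by
    intro n
    induction n with
    | zero => simpa using ⟨hc, hne⟩
    | succ n ih =>
      obtain ⟨ih1, ih2⟩ := ih
      rw [hstep, div_div, ← pow_succ] at ih2
      refine ⟨?_, right_ne_zero_of_mul ih2⟩
      have := hM _ ih1 0 hL0
      rw [g_zero, hα, one_mul, div_div, ← pow_succ] at this
      exact this (left_ne_zero_of_mul ih2)
  have hinj : Function.Injective fun n : ℕ => c / (R : ℝ) ^ n := by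
    intro m n hmn
    have h1 : |(R : ℝ)| ^ m = |(R : ℝ)| ^ n := by
      have : (R : ℝ) ^ m = (R : ℝ) ^ n := by
        simpa [div_eq_mul_inv, hc0] using hmn
      rw [← abs_pow, ← abs_pow, this]
    have h2 : (2 : ℝ) ≤ |(R : ℝ)| := by exact_mod_cast hR
    exact pow_right_injective₀ (by linarith) (by linarith) h1
  exact Set.infinite_of_injective_forall_mem hinj (fun n => (hall n).1) hfin

lemma coeff_expo_eq_zero {R : ℤ} (hR : 2 ≤ |R|) {B L : Finset ℤ} (hL0 : 0 ∈ L)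
    {μ : Measure ℝ} (hμ : IsSelfAffineMeasure R B μ) {α : ℤ → ℂ} (hα : α 0 = 1) {M : Set ℝ}
    (hfin : M.Finite) (hM : IsInvariant R B L α M) (h0 : (0 : ℝ) ∉ M) {w : List ℤ}
    (hw : ∀ l ∈ w, l ∈ L) {c : ℝ} (hc : c ∈ M) : coeff R α μ w (expo c) = 0 := by
  have hR0 : R ≠ 0 := by rintro rfl; simp at hR
  induction w generalizing c with
  | nil => exact coeff_nil_expo_eq_zero hR hL0 hμ hα hfin hM hc fun h => h0 (h ▸ hc)
  | cons l w ih =>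
    rw [hμ.coeff_cons_expo hR0]
    -- Either the transition has weight 0, or it leads to another point of `M`, where the shorter
    -- word applies.
    by_cases hne : α l * mB B (g R l c) = 0
    · rcases mul_eq_zero.1 hne with h | h <;> simp [h]
    · rw [ih (fun k hk => hw k (List.mem_cons_of_mem _ hk))
        (hM c hc l (hw l List.mem_cons_self) hne), mul_zero]

end WeightedFourier

end

theorem theorem4p3 (R : ℤ) (hR : 2 ≤ |R|) (B : Finset ℤ) (hB0 : 0 ∈ B)
    (hno : WeightedFourier.NoOverlap R B)
    (L : Finset ℤ) (hL0 : 0 ∈ L) (α : ℤ → ℂ)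
    (hi : α 0 = 1)
    (hii : (WeightedFourier.matT R B L α)ᴴ * WeightedFourier.matT R B L α = 1) :
    ((∀ M : Set ℝ, WeightedFourier.IsFiniteMinimalInvariant R B L α M → M = {0}) →
      WeightedFourier.OnlyConstantHarmonic R B L α ∧
      WeightedFourier.IsParsevalFrame (WeightedFourier.weightedExp R B L α)) ∧
    (∀ M : Set ℝ, WeightedFourier.IsFiniteMinimalInvariant R B L α M → M ≠ {0} →
      (∀ c ∈ M, ∀ w : WeightedFourier.Words L,
        inner ℂ (WeightedFourier.weightedExp R B L α w)
          (WeightedFourier.expL2 (WeightedFourier.selfAffineMeasure R B) c) = 0) ∧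
      (Submodule.span ℂ (Set.range (WeightedFourier.weightedExp R B L α))).topologicalClosure
        ≠ ⊤) := by
  have hR0 : R ≠ 0 := by rintro rfl; simp at hR
  have hB : B.Nonempty := ⟨0, hB0⟩
  have hμ := WeightedFourier.isSelfAffineMeasure_selfAffineMeasure hR hB
  have := hμ.isProbabilityMeasure
  refine ⟨fun hmin => ⟨WeightedFourier.onlyConstantHarmonic_of_minimal hR hB hii hmin,
    WeightedFourier.isParsevalFrame_weightedExp hR hB hL0 hi hii hmin⟩, fun M hM hM0 => ?_⟩
  have h0 := WeightedFourier.zero_notMem_of_minimal hR0 hB hL0 hi hii hM hM0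
  have horth : ∀ c ∈ M, ∀ w : WeightedFourier.Words L,
      inner ℂ (WeightedFourier.weightedExp R B L α w)
        (WeightedFourier.expL2 (WeightedFourier.selfAffineMeasure R B) c) = 0 := by
    intro c hc w
    rw [WeightedFourier.inner_weightedExp_expL2]
    exact WeightedFourier.coeff_expo_eq_zero hR hL0 hμ hi hM.1 hM.2.prop.2 h0 w.2.1 hc
  refine ⟨horth, fun htop => ?_⟩
  obtain ⟨c, hc⟩ := hM.2.prop.1
  -- A unit vector orthogonal to the span rules out density.
  have hmem : WeightedFourier.expL2 (WeightedFourier.selfAffineMeasure R B) c ∈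
      (Submodule.span ℂ (Set.range (WeightedFourier.weightedExp R B L α)))ᗮ := by
    rw [Submodule.mem_orthogonal]
    intro u hu
    induction hu using Submodule.span_induction with
    | mem u hu => obtain ⟨w, rfl⟩ := hu; exact horth c hc w
    | zero => exact inner_zero_left _
    | add u v _ _ hu hv => rw [inner_add_left, hu, hv, add_zero]
    | smul a u _ hu => rw [inner_smul_left, hu, mul_zero]
  rw [Submodule.topologicalClosure_eq_top_iff.1 htop, Submodule.mem_bot] at hmem
  have hnorm := WeightedFourier.norm_expL2 (WeightedFourier.selfAffineMeasure R B) c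
  rw [hmem] at hnorm
  simp at hnorm
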